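/- **P-categories.** A \emph{functorial path} on a category $\mathcal C$ is a functor $P:\mathcal C\to\mathcal C$ with natural transformations $\iota:1\to P$ and $\delta^0,\delta^1:P\to 1$ such that $\delta^0\iota=\delta^1\iota=1$. A \emph{P-category} is a category $\mathcal C$ with finite products and final object $e$, a functorial path together with * a symmetry $\tau:P\to P$ ($\tau\tau=1$, $\tau\iota=\iota$, $\delta^k\tau=\delta^{1-k}$), * an interchange, i.e. a natural automorphism $\mu$ of $P^2$ with $\delta^k_{P(A)}\mu_A=P(\delta^k_A)$ and $P(\delta^k_A)\mu_A=\delta^k_{P(A)}$, * a coproduct $c:P\to P^2$ ($(P,\delta^1,c)$ is a comonad, $c_A\iota_A=\iota_{P(A)}\iota_A$, $\delta^0_{P(A)}c_A=P(\delta^0_A)c_A=\iota_A\delta^0_A$), * a folding map $\nabla:P^2\to P$ ($\delta^k_A\nabla_A=\delta^k_A\delta^k_{P(A)}$, $\nabla_A\iota_{P(A)}=1$), and two classes of morphisms $\mathcal F$ (fibrations) and $\mathcal W$ (weak equivalences) such that: * (P$_1$) both classes contain the isomorphisms and are closed under composition, $\mathcal W$ has the two out of three property, and every $A\to e$ is a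 fibration; * (P$_2$) $\iota_A\in\mathcal W$, $(\delta^0_A,\delta^1_A):P(A)\to A\times A$ is a fibration, and $\delta^0_A,\delta^1_A$ are trivial fibrations (i.e. lie in $\mathcal F\cap\mathcal W$); * (P$_3$) for $u:A\to C$ and a fibration $v:B\to C$ the fibre product $A\times_CB$ exists, $\pi_1:A\times_CB\to A$ is a fibration, which is trivial if $v$ is, and $\pi_2:A\times_CB\to B$ is a weak equivalence if $u$ is; * (P$_4$) $P$ preserves $\mathcal F$, $\mathcal W$ and these fibre products; * (P$_5$) for every fibration $v:A\to B$ the induced map $P(A)\to (A\times A)\times_{B\times B}P(B)$ is a fibration. An object is \emph{cofibrant} if it has the left lifting property with respect to all trivial fibrations. **Diagrams.** Let $I$ be a finite category with a degree function $|\cdot|:\mathrm{Ob}(I)\to\{0,1\}$ such that $|i|<|j|$ for every non-identity $u:i\to j$. Let $\mathcal C:I\to\mathsf{Cat}$ be a functor; write $\mathcal C_i=\mathcal C(i)$ and $u_*=\mathcal C(u)$. Assume that every $\mathcal C_i$ is a P-category and that every $u_*$ preserves the functorial path $(P,\iota,\delta^0,\delta^1)$, fibrations, weak equivalences and the fibre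 products along fibrations. Let $\Gamma\mathcal C$ be the category of sections of $\int_I\mathcal C\to I$: its objects are families $A=(A_i\in\mathcal C_i,\ \varphi_u:u_*(A_i)\to A_j)$, $u:i\to j$ running over the non-identity morphisms of $I$, and its morphisms are the level-wise morphisms commuting with the $\varphi_u$. Let $P(A)$ be the level-wise path of $A$, with comparison morphisms $P(\varphi_u)$, and let $\mathcal W$ be the class of level-wise weak equivalences. Let $\Gamma\mathcal C_{cof}$ be the full subcategory of those $A$ for which $A_i$ is cofibrant in $\mathcal C_i$ for all $i$ and $u_*(A_i)$ is cofibrant in $\mathcal C_j$ for all $u:i\to j$. **Ho-morphisms.** A \emph{ho-morphism} $f:A\rightsquigarrow B$ is a family $(f_i,F_u)$ with $f_i:A_i\to B_i$ and, for all non-identity $u:i\to j$, $F_u:u_*(A_i)\to P(B_j)$ with $\delta^0F_u=f_j\varphi_u$ and $\delta^1F_u=\varphi_u\,u_*(f_i)$. Morphisms of $\Gamma\mathcal C$ are ho-morphisms with $F_u=\iota f_j\varphi_u$, and ho-morphisms can be composed with morphisms on either side. Ho-morphisms $f,g:A\rightsquigarrow B$ are \emph{homotopic} if there is a ho-morphism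 $h:A\rightsquigarrow P(B)$ with $\delta^0h=f$ and $\delta^1h=g$; let $[A,B]^h$ be the set of ho-morphisms modulo the equivalence relation $\sim$ generated by homotopy. A morphism $f:A\to B$ is a \emph{ho-equivalence} if there is a ho-morphism $g:B\rightsquigarrow A$ with $gf\sim 1_A$ and $fg\sim 1_B$; let $\mathcal H$ be the closure under composition of the class of ho-equivalences. The \emph{mapping path} of $f:A\rightsquigarrow B$ is the diagram with levels $\mathcal P(f_i)=A_i\times_{B_i}P(B_i)$ (formed with $f_i$ and $\delta^0$) and comparison morphisms $(\varphi_u,F_u)\circ u_*(\pi_1)$. For ho-morphisms $f:A\rightsquigarrow B$ and $g:B\rightsquigarrow C$, denote by $g*f$ any ho-morphism $(g_if_i,\nabla L_u)$, where $L_u:u_*(A_i)\to P^2(C_j)$ satisfies $\delta^0_{P(C_j)}L_u=P(g_j)F_u$ and $P(\delta^1_{C_j})L_u=G_u\,u_*(f_i)$. **Cartan-Eilenberg categories.** Let $\mathcal S,\mathcal W$ be classes of morphisms of a category $\mathcal K$ such that all morphisms in $\mathcal S$ become invertible in $\mathrm{Ho}(\mathcal K)=\mathcal K[\mathcal W^{-1}]$.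 An object $N$ is \emph{Cartan-Eilenberg cofibrant} if $w_*:\mathcal K[\mathcal S^{-1}](N,Y)\to\mathcal K[\mathcal S^{-1}](N,X)$ is bijective for every $w:Y\to X$ in $\mathcal W$; it is a \emph{model} of $X$ if there is a morphism $N\to X$ of $\mathcal K[\mathcal S^{-1}]$ that becomes an isomorphism in $\mathcal K[\mathcal W^{-1}]$. The triple $(\mathcal K,\mathcal S,\mathcal W)$ is a \emph{left Cartan-Eilenberg category} if every object has a Cartan-Eilenberg cofibrant model; a full subcategory $\mathcal M$ is a \emph{full subcategory of cofibrant models} if its objects are Cartan-Eilenberg cofibrant and every object of $\mathcal K$ has a model in $\mathcal M$. **Theorem.** Let $\mathcal D$ be a full subcategory of $\Gamma\mathcal C$ such that: 1. the mapping path of every ho-morphism between objects of $\mathcal D$ is (isomorphic to) an object of $\mathcal D$; 2. there is a full subcategory $\mathcal M\subset\mathcal D\cap\Gamma\mathcal C_{cof}$ such that for every object $X$ of $\mathcal D$ there are an object $N$ of $\mathcal M$ and a ho-morphism $N\rightsquigarrow X$ which is a level-wise weak equivalence. Then, with $\mathcal H$ and $\mathcal W$ restricted to $\mathcal D$, the triple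 $(\mathcal D,\mathcal H,\mathcal W)$ is a left Cartan-Eilenberg category, and $\mathcal M$ is a full subcategory of cofibrant models. The objects of $\mathcal M$ and the sets $[A,B]^h$ form a category $\pi^h\mathcal M$ with composition $[g][f]=[g*f]$ (some $g*f$ exists, and the class does not depend on the choices) and identities $[1_A]$, and the inclusion induces an equivalence of categories $$\Phi:\pi^h\mathcal M\stackrel{\sim}{\longrightarrow}\mathrm{Ho}(\mathcal D)=\mathcal D[\mathcal W^{-1}],$$ where $\Phi$ is the identity on objects and $\Phi[f]\circ p=q$ in $\mathrm{Ho}(\mathcal D)$ whenever $f:A\rightsquigarrow B$ is a ho-morphism between objects of $\mathcal M$ and $p:X\to A$, $q:X\to B$ are morphisms of $\mathcal D$ with $fp\sim q$ (in particular $\Phi[f]=f$ for every morphism $f$ of $\mathcal M$). -/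

import Mathlib

open CategoryTheory CategoryTheory.Limits

universe w v u

namespace HoDiagrams

/-! ### Categories with a functorial path, and P-categories -/

/-- A functorial path on `C`: a functor `P` with natural transformations `ι : 1 ⟶ P` and
`δ₀, δ₁ : P ⟶ 1` such that `δ₀ ι = δ₁ ι = 1`. -/
structure FunctorialPath (C : Type u) [Category.{v} C] where
  P : C ⥤ C
  ι : 𝟭 C ⟶ P
  δ₀ : P ⟶ 𝟭 C
  δ₁ : P ⟶ 𝟭 C
  ι_δ₀ (A : C) : ι.app A ≫ δ₀.app A = 𝟙 A
  ι_δ₁ (A : C) : ι.app A ≫ δ₁.app A = 𝟙 A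

/-- A functorial path together with a symmetry `τ`, an interchange `μ`, a coproduct `c` and a
folding map `fold` (usually written `∇`). Composites are written in diagrammatic order. -/
structure StructuredPath (C : Type u) [Category.{v} C] extends FunctorialPath C where
  /-- symmetry -/
  τ : P ⟶ P
  τ_τ (A : C) : τ.app A ≫ τ.app A = 𝟙 (P.obj A)
  ι_τ (A : C) : ι.app A ≫ τ.app A = ι.app A
  τ_δ₀ (A : C) : τ.app A ≫ δ₀.app A = δ₁.app A
  τ_δ₁ (A : C) : τ.app A ≫ δ₁.app A = δ₀.app A
  /-- interchange -/
  μ : P ⋙ P ≅ P ⋙ P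
  μ_δ₀ (A : C) : μ.hom.app A ≫ δ₀.app (P.obj A) = P.map (δ₀.app A)
  μ_δ₁ (A : C) : μ.hom.app A ≫ δ₁.app (P.obj A) = P.map (δ₁.app A)
  μ_P_δ₀ (A : C) : μ.hom.app A ≫ P.map (δ₀.app A) = δ₀.app (P.obj A)
  μ_P_δ₁ (A : C) : μ.hom.app A ≫ P.map (δ₁.app A) = δ₁.app (P.obj A)
  /-- coproduct -/
  c : P ⟶ P ⋙ P
  c_assoc (A : C) : c.app A ≫ c.app (P.obj A) = c.app A ≫ P.map (c.app A)
  c_δ₁ (A : C) : c.app A ≫ δ₁.app (P.obj A) = 𝟙 (P.obj A)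
  c_P_δ₁ (A : C) : c.app A ≫ P.map (δ₁.app A) = 𝟙 (P.obj A)
  ι_c (A : C) : ι.app A ≫ c.app A = ι.app A ≫ ι.app (P.obj A)
  c_δ₀ (A : C) : c.app A ≫ δ₀.app (P.obj A) = δ₀.app A ≫ ι.app A
  c_P_δ₀ (A : C) : c.app A ≫ P.map (δ₀.app A) = δ₀.app A ≫ ι.app A
  /-- folding map -/
  fold : P ⋙ P ⟶ P
  fold_δ₀ (A : C) : fold.app A ≫ δ₀.app A = δ₀.app (P.obj A) ≫ δ₀.app A
  fold_δ₁ (A : C) : fold.app A ≫ δ₁.app A = δ₁.app (P.obj A) ≫ δ₁.app A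
  ι_fold (A : C) : ι.app (P.obj A) ≫ fold.app A = 𝟙 (P.obj A)

/-- A P-category structure on a category with finite products: a functorial path with symmetry,
interchange, coproduct and folding map, and classes `Fib` of fibrations and `Weq` of weak
equivalences satisfying the axioms (P1)-(P5). -/
structure PCategory (C : Type u) [Category.{v} C] [HasFiniteProducts C]
    extends StructuredPath C where
  Fib : MorphismProperty C
  Weq : MorphismProperty C
  -- (P1)
  iso_fib {A B : C} (f : A ⟶ B) [IsIso f] : Fib f
  iso_weq {A B : C} (f : A ⟶ B) [IsIso f] : Weq f
  fib_comp : Fib.IsStableUnderComposition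
  weq_twoOutOfThree : Weq.HasTwoOutOfThreeProperty
  fib_terminal (A : C) : Fib (terminal.from A)
  -- (P2)
  weq_ι (A : C) : Weq (ι.app A)
  fib_δ (A : C) : Fib (prod.lift (δ₀.app A) (δ₁.app A))
  fib_δ₀ (A : C) : Fib (δ₀.app A)
  weq_δ₀ (A : C) : Weq (δ₀.app A)
  fib_δ₁ (A : C) : Fib (δ₁.app A)
  weq_δ₁ (A : C) : Weq (δ₁.app A)
  -- (P3)
  hasPullback {A B X : C} (g : A ⟶ X) (p : B ⟶ X) (hp : Fib p) : HasPullback g p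
  fib_fst {A B X Y : C} {fst : Y ⟶ A} {snd : Y ⟶ B} {g : A ⟶ X} {p : B ⟶ X}
    (sq : IsPullback fst snd g p) (hp : Fib p) : Fib fst
  weq_fst {A B X Y : C} {fst : Y ⟶ A} {snd : Y ⟶ B} {g : A ⟶ X} {p : B ⟶ X}
    (sq : IsPullback fst snd g p) (hp : Fib p) (hp' : Weq p) : Weq fst
  weq_snd {A B X Y : C} {fst : Y ⟶ A} {snd : Y ⟶ B} {g : A ⟶ X} {p : B ⟶ X}
    (sq : IsPullback fst snd g p) (hp : Fib p) (hg : Weq g) : Weq snd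
  -- (P4)
  fib_map {A B : C} (f : A ⟶ B) (hf : Fib f) : Fib (P.map f)
  weq_map {A B : C} (f : A ⟶ B) (hf : Weq f) : Weq (P.map f)
  isPullback_map {A B X Y : C} {fst : Y ⟶ A} {snd : Y ⟶ B} {g : A ⟶ X} {p : B ⟶ X}
    (sq : IsPullback fst snd g p) (hp : Fib p) :
    IsPullback (P.map fst) (P.map snd) (P.map g) (P.map p)
  -- (P5): `Y` is the double mapping path of `(p, p)`, and the map in question is the induced
  -- morphism `P(A) ⟶ Y`
  fib_double {A B Y : C} (p : A ⟶ B) (hp : Fib p) {fst : Y ⟶ A ⨯ A} {snd : Y ⟶ P.obj B}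
    (sq : IsPullback fst snd (prod.map p p) (prod.lift (δ₀.app B) (δ₁.app B)))
    (r : P.obj A ⟶ Y) (hr₁ : r ≫ fst = prod.lift (δ₀.app A) (δ₁.app A))
    (hr₂ : r ≫ snd = P.map p) : Fib r

/-- An object of a P-category is cofibrant if it lifts against all trivial fibrations. -/
def PCategory.IsCofibrant {C : Type u} [Category.{v} C] [HasFiniteProducts C] (S : PCategory C)
    (X : C) : Prop :=
  ∀ ⦃A B : C⦄ (p : A ⟶ B), S.Fib p → S.Weq p → ∀ f : X ⟶ B, ∃ g : X ⟶ A, g ≫ p = f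

/-! ### Diagram categories -/

/-- `u` is not an identity morphism. -/
def NonIdentity {I : Type w} [Category.{w} I] {i j : I} (a : i ⟶ j) : Prop :=
  ¬ ∃ h : i = j, a = eqToHom h

/-- The functor `a_* : C_i ⥤ C_j` attached to `a : i ⟶ j`. -/
abbrev push {I : Type w} [Category.{w} I] (C : I ⥤ Cat.{v, u}) {i j : I} (a : i ⟶ j) :
    C.obj i ⥤ C.obj j :=
  (C.map a).toFunctor

/-- Objects of the category of diagrams associated with `C : I ⥤ Cat`, that is, sections of the
projection from the Grothendieck construction of `C` to `I`, for an index category `I` with a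
binary degree function. The comparison morphism at an identity is the identity, and in such an `I`
no two non-identity morphisms can be composed, so that a section amounts to an arbitrary choice of
the objects and of the comparison morphisms `φ_a : a_*(A_i) ⟶ A_j` for the non-identity `a`. -/
structure Diagram {I : Type w} [Category.{w} I] (C : I ⥤ Cat.{v, u}) where
  obj (i : I) : C.obj i
  φ {i j : I} (a : i ⟶ j) (ha : NonIdentity a) : (push C a).obj (obj i) ⟶ obj j

section Diagrams

variable {I : Type w} [Category.{w} I] {C : I ⥤ Cat.{v, u}}

/-- Morphisms of diagrams: level-wise morphisms commuting with the comparison morphisms (with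
those at identities they commute automatically). -/
@[ext]
structure Diagram.Hom (A B : Diagram C) where
  app (i : I) : A.obj i ⟶ B.obj i
  comm {i j : I} (a : i ⟶ j) (ha : NonIdentity a) :
    A.φ a ha ≫ app j = (push C a).map (app i) ≫ B.φ a ha

instance : Category (Diagram C) where
  Hom := Diagram.Hom
  id A := { app := fun i => 𝟙 (A.obj i), comm := fun a ha => by simp }
  comp f g :=
    { app := fun i => f.app i ≫ g.app i
      comm := fun a ha => by
        rw [← Category.assoc, f.comm a ha, Category.assoc, g.comm a ha]; simp }
  id_comp f := by apply Diagram.Hom.ext; funext i; exact Category.id_comp _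
  comp_id f := by apply Diagram.Hom.ext; funext i; exact Category.comp_id _
  assoc f g h := by apply Diagram.Hom.ext; funext i; exact Category.assoc _ _ _

end Diagrams

/-- Axiom (I1), apart from the finiteness of the index category: a degree function with values in
`{0, 1}` which is strictly increasing along the non-identity morphisms. -/
structure BinaryDegree (I : Type w) [Category.{w} I] where
  deg : I → Fin 2
  deg_lt {i j : I} (a : i ⟶ j) (ha : NonIdentity a) : deg i < deg j

/-- Axioms (I2) and (I3): every `C_i` is a P-category, and every `a_* : C_i ⥤ C_j` preserves
the functorial path `(P, ι, δ₀, δ₁)` (up to a given natural isomorphism `P a_* ≅ a_* P`),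
fibrations, weak equivalences, and fibre products (those which the axioms of a P-category provide,
that is, along fibrations). -/
structure PDiagram {I : Type w} [Category.{w} I] (C : I ⥤ Cat.{v, u})
    [∀ i, HasFiniteProducts (C.obj i)] where
  pcat (i : I) : PCategory (C.obj i)
  pathIso {i j : I} (a : i ⟶ j) : push C a ⋙ (pcat j).P ≅ (pcat i).P ⋙ push C a
  pathIso_ι {i j : I} (a : i ⟶ j) (A : C.obj i) :
    (pcat j).ι.app ((push C a).obj A) ≫ (pathIso a).hom.app A =
      (push C a).map ((pcat i).ι.app A)
  pathIso_δ₀ {i j : I} (a : i ⟶ j) (A : C.obj i) :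
    (pathIso a).hom.app A ≫ (push C a).map ((pcat i).δ₀.app A) =
      (pcat j).δ₀.app ((push C a).obj A)
  pathIso_δ₁ {i j : I} (a : i ⟶ j) (A : C.obj i) :
    (pathIso a).hom.app A ≫ (push C a).map ((pcat i).δ₁.app A) =
      (pcat j).δ₁.app ((push C a).obj A)
  push_fib {i j : I} (a : i ⟶ j) {A B : C.obj i} (f : A ⟶ B) (hf : (pcat i).Fib f) :
    (pcat j).Fib ((push C a).map f)
  push_weq {i j : I} (a : i ⟶ j) {A B : C.obj i} (f : A ⟶ B) (hf : (pcat i).Weq f) :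
    (pcat j).Weq ((push C a).map f)
  push_isPullback {i j : I} (a : i ⟶ j) {A B X Y : C.obj i} {fst : Y ⟶ A} {snd : Y ⟶ B}
    {g : A ⟶ X} {p : B ⟶ X} (sq : IsPullback fst snd g p) (hp : (pcat i).Fib p) :
    IsPullback ((push C a).map fst) ((push C a).map snd) ((push C a).map g) ((push C a).map p)

namespace PDiagram

variable {I : Type w} [Category.{w} I] {C : I ⥤ Cat.{v, u}}
  [∀ i, HasFiniteProducts (C.obj i)] (S : PDiagram C)

/-- Level-wise weak equivalences of diagrams. -/
def weq : MorphismProperty (Diagram C) := fun _ _ f => ∀ i, (S.pcat i).Weq (f.app i)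

/-- The level-wise cofibrant diagrams: all `A_i`, and also all `a_*(A_i)` for `a : i ⟶ j`, are
cofibrant objects of the categories in which they lie. -/
def cof : ObjectProperty (Diagram C) := fun A =>
  (∀ i, (S.pcat i).IsCofibrant (A.obj i)) ∧
    ∀ ⦃i j : I⦄ (a : i ⟶ j), (S.pcat j).IsCofibrant ((push C a).obj (A.obj i))

/-- The level-wise path object of a diagram; its comparison morphism is `P(φ_a)`. -/
def path (B : Diagram C) : Diagram C where
  obj i := (S.pcat i).P.obj (B.obj i)
  φ {i j} a ha := (S.pathIso a).inv.app (B.obj i) ≫ (S.pcat j).P.map (B.φ a ha)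

/-- The morphism `δ₀ : P(B) ⟶ B` of diagrams. -/
def pathδ₀ (B : Diagram C) : S.path B ⟶ B where
  app i := (S.pcat i).δ₀.app (B.obj i)
  comm {i j} a ha := by
    have h := (S.pcat j).δ₀.naturality (B.φ a ha)
    simp only [Functor.id_map] at h
    simp only [path, Category.assoc]
    erw [h, ← S.pathIso_δ₀ a (B.obj i)]
    simp

/-- The morphism `δ₁ : P(B) ⟶ B` of diagrams. -/
def pathδ₁ (B : Diagram C) : S.path B ⟶ B where
  app i := (S.pcat i).δ₁.app (B.obj i)
  comm {i j} a ha := by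
    have h := (S.pcat j).δ₁.naturality (B.φ a ha)
    simp only [Functor.id_map] at h
    simp only [path, Category.assoc]
    erw [h, ← S.pathIso_δ₁ a (B.obj i)]
    simp

/-! ### Ho-morphisms -/

/-- A ho-morphism `A ⇝ B`: level-wise morphisms `f_i` with homotopies `F_a : a_*(A_i) ⟶ P(B_j)`
from `f_j φ_a` to `φ_a f_i`, for the non-identity morphisms `a : i ⟶ j` of the index category. -/
@[ext]
structure HoMor (A B : Diagram C) where
  app (i : I) : A.obj i ⟶ B.obj i
  htpy {i j : I} (a : i ⟶ j) (ha : NonIdentity a) :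
    (push C a).obj (A.obj i) ⟶ (S.pcat j).P.obj (B.obj j)
  htpy_δ₀ {i j : I} (a : i ⟶ j) (ha : NonIdentity a) :
    htpy a ha ≫ (S.pcat j).δ₀.app (B.obj j) = A.φ a ha ≫ app j
  htpy_δ₁ {i j : I} (a : i ⟶ j) (ha : NonIdentity a) :
    htpy a ha ≫ (S.pcat j).δ₁.app (B.obj j) = (push C a).map (app i) ≫ B.φ a ha

/-- A morphism regarded as a ho-morphism, with the constant homotopies. -/
def HoMor.ofHom {A B : Diagram C} (f : A ⟶ B) : S.HoMor A B where
  app := f.app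
  htpy {_ j} a ha := (A.φ a ha ≫ f.app j) ≫ (S.pcat j).ι.app (B.obj j)
  htpy_δ₀ {_ j} a ha := by
    rw [Category.assoc]
    erw [(S.pcat j).ι_δ₀ (B.obj j), Category.comp_id]
  htpy_δ₁ {_ j} a ha := by
    rw [Category.assoc]
    erw [(S.pcat j).ι_δ₁ (B.obj j), Category.comp_id]
    exact f.comm a ha

variable {S}

/-- The ho-morphism `f g` for a ho-morphism `f` and a morphism `g`. -/
def HoMor.precomp {A' A B : Diagram C} (f : S.HoMor A B) (g : A' ⟶ A) : S.HoMor A' B where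
  app i := g.app i ≫ f.app i
  htpy {i _} a ha := (push C a).map (g.app i) ≫ f.htpy a ha
  htpy_δ₀ {i j} a ha := by
    rw [Category.assoc]
    erw [f.htpy_δ₀ a ha]
    rw [← Category.assoc, ← g.comm a ha, Category.assoc]
  htpy_δ₁ {i j} a ha := by
    rw [Category.assoc]
    erw [f.htpy_δ₁ a ha]
    simp

/-- The ho-morphism `h f` for a morphism `h` and a ho-morphism `f`. -/
def HoMor.postcomp {A B B' : Diagram C} (f : S.HoMor A B) (h : B ⟶ B') : S.HoMor A B' where
  app i := f.app i ≫ h.app i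
  htpy {_ j} a ha := f.htpy a ha ≫ (S.pcat j).P.map (h.app j)
  htpy_δ₀ {i j} a ha := by
    have e := (S.pcat j).δ₀.naturality (h.app j)
    simp only [Functor.id_map] at e
    rw [Category.assoc]
    erw [e]
    rw [← Category.assoc]
    erw [f.htpy_δ₀ a ha]
    simp
  htpy_δ₁ {i j} a ha := by
    have e := (S.pcat j).δ₁.naturality (h.app j)
    simp only [Functor.id_map] at e
    rw [Category.assoc]
    erw [e]
    rw [← Category.assoc]
    erw [f.htpy_δ₁ a ha]
    rw [Category.assoc, h.comm a ha]
    simp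

/-- `f ≃ g`: there is a ho-morphism `h : A ⇝ P(B)` with `δ₀ h = f` and `δ₁ h = g`. -/
def Homotopic {A B : Diagram C} (f g : S.HoMor A B) : Prop :=
  ∃ h : S.HoMor A (S.path B), h.postcomp (S.pathδ₀ B) = f ∧ h.postcomp (S.pathδ₁ B) = g

/-- `f` is a level-wise weak equivalence. -/
def HoMor.IsWeq {A B : Diagram C} (f : S.HoMor A B) : Prop :=
  ∀ i, (S.pcat i).Weq (f.app i)

variable (S)

/-- `[A, B]^h`: ho-morphisms modulo the equivalence relation generated by homotopy. -/
def HoClass (A B : Diagram C) := Quot (Homotopic (S := S) (A := A) (B := B))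

variable {S}

/-- The class of a ho-morphism. Two ho-morphisms have the same class if and only if they are
connected by a chain of homotopies. -/
def HoMor.toClass {A B : Diagram C} (f : S.HoMor A B) : S.HoClass A B := Quot.mk _ f

variable (S)

/-- The ho-equivalences: the morphisms `f : A ⟶ B` for which there is a ho-morphism `g : B ⇝ A`
with `g f` and `f g` connected by chains of homotopies to the identities. -/
def hoEquiv : MorphismProperty (Diagram C) := fun A B f =>
  ∃ g : S.HoMor B A,
    (g.precomp f).toClass = (HoMor.ofHom S (𝟙 A)).toClass ∧
    (g.postcomp f).toClass = (HoMor.ofHom S (𝟙 B)).toClass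

/-- The class `𝓗`: the closure by composition of the class of ho-equivalences. -/
def hoEquivClosure : MorphismProperty (Diagram C) := S.hoEquiv.multiplicativeClosure

lemma hasPullback_mappingPath {i : I} {X Y : C.obj i} (f : X ⟶ Y) :
    HasPullback f ((S.pcat i).δ₀.app Y) :=
  (S.pcat i).hasPullback _ _ ((S.pcat i).fib_δ₀ _)

variable {S}

/-- The mapping path of a ho-morphism `f`: the level-wise mapping paths
`𝓟(f_i) = A_i ×_{B_i} P(B_i)` (with respect to `f_i` and `δ₀`), with the comparison morphisms
`(φ_a, F_a) π₁`. -/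
noncomputable def mappingPath {A B : Diagram C} (f : S.HoMor A B) : Diagram C where
  obj i :=
    haveI := S.hasPullback_mappingPath (f.app i)
    pullback (f.app i) ((S.pcat i).δ₀.app (B.obj i))
  φ {i j} a ha :=
    haveI := S.hasPullback_mappingPath (f.app i)
    haveI := S.hasPullback_mappingPath (f.app j)
    (push C a).map (pullback.fst (f.app i) ((S.pcat i).δ₀.app (B.obj i))) ≫
      pullback.lift (A.φ a ha) (f.htpy a ha) (f.htpy_δ₀ a ha).symm

/-! ### The category of homotopy classes of ho-morphisms -/

/-- `k = g * f` for some choice of concatenations: `k_i = g_i f_i`, and the homotopies of `k` are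
concatenations of `P(g_j) F_a` and `G_a f_i`, that is, `K_a = ∇ L_a` for some `L_a` with
`δ₀ L_a = P(g_j) F_a` and `P(δ₁) L_a = G_a f_i`. -/
def IsConcat {A B E : Diagram C} (f : S.HoMor A B) (g : S.HoMor B E) (k : S.HoMor A E) : Prop :=
  (∀ i, k.app i = f.app i ≫ g.app i) ∧
  ∀ ⦃i j : I⦄ (a : i ⟶ j) (ha : NonIdentity a),
    ∃ L : (push C a).obj (A.obj i) ⟶ (S.pcat j).P.obj ((S.pcat j).P.obj (E.obj j)),
      L ≫ (S.pcat j).δ₀.app ((S.pcat j).P.obj (E.obj j)) =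
        f.htpy a ha ≫ (S.pcat j).P.map (g.app j) ∧
      L ≫ (S.pcat j).P.map ((S.pcat j).δ₁.app (E.obj j)) =
        (push C a).map (f.app i) ≫ g.htpy a ha ∧
      k.htpy a ha = L ≫ (S.pcat j).fold.app (E.obj j)

variable (S)

/-- The assertion that the objects of `M` and the homotopy classes of ho-morphisms form a category
`π^h M`: a composition law with `[g][f] = [g * f]` for every choice of `g * f` (and such choices
exist), which is associative and has the classes of the identities as units. There is at most one
such structure. -/
structure PiH (M : ObjectProperty (Diagram C)) where
  comp {A B E : M.FullSubcategory} :
    S.HoClass A.obj B.obj → S.HoClass B.obj E.obj → S.HoClass A.obj E.obj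
  exists_concat {A B E : M.FullSubcategory} (f : S.HoMor A.obj B.obj) (g : S.HoMor B.obj E.obj) :
    ∃ k, IsConcat f g k
  comp_eq {A B E : M.FullSubcategory} (f : S.HoMor A.obj B.obj) (g : S.HoMor B.obj E.obj)
    (k : S.HoMor A.obj E.obj) (hk : IsConcat f g k) : comp f.toClass g.toClass = k.toClass
  id_comp {A B : M.FullSubcategory} (f : S.HoClass A.obj B.obj) :
    comp (HoMor.ofHom S (𝟙 A.obj)).toClass f = f
  comp_id {A B : M.FullSubcategory} (f : S.HoClass A.obj B.obj) :
    comp f (HoMor.ofHom S (𝟙 B.obj)).toClass = f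
  assoc {A B E F : M.FullSubcategory} (f : S.HoClass A.obj B.obj) (g : S.HoClass B.obj E.obj)
    (h : S.HoClass E.obj F.obj) : comp (comp f g) h = comp f (comp g h)

variable {S}

/-- The objects of `π^h M`. -/
def PiH.Carrier {M : ObjectProperty (Diagram C)} (_ : S.PiH M) := M.FullSubcategory

instance {M : ObjectProperty (Diagram C)} (T : S.PiH M) : Category T.Carrier where
  Hom (A B : M.FullSubcategory) := S.HoClass A.obj B.obj
  id (A : M.FullSubcategory) := (HoMor.ofHom S (𝟙 A.obj)).toClass
  comp f g := T.comp f g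
  id_comp f := T.id_comp f
  comp_id f := T.comp_id f
  assoc f g h := T.assoc f g h

variable (S)

/-- The level-wise weak equivalences between objects of the full subcategory `D`. -/
def weqOn (D : ObjectProperty (Diagram C)) : MorphismProperty D.FullSubcategory :=
  S.weq.inverseImage D.ι

/-- The morphisms of the class `𝓗` between objects of the full subcategory `D`. -/
def hoEquivOn (D : ObjectProperty (Diagram C)) : MorphismProperty D.FullSubcategory :=
  S.hoEquivClosure.inverseImage D.ι

variable {S}

/-- A functor `π^h M ⥤ Ho(D)` induced by the inclusion of `M` in `D`: it is the inclusion on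
objects, and it sends the class of a ho-morphism `f` to a morphism `Φ[f]` such that `Φ[f] p = q`
in `Ho(D)` for all morphisms `p`, `q` of `D` with `f p ∼ q`. (In particular `Φ[f] = f` for every
morphism `f` of `M`.) -/
structure PiH.InducedFunctor {M D : ObjectProperty (Diagram C)} (T : S.PiH M) (hMD : M ≤ D) where
  map {A B : M.FullSubcategory} : S.HoClass A.obj B.obj →
    ((S.weqOn D).Q.obj ((ObjectProperty.ιOfLE hMD).obj A) ⟶
      (S.weqOn D).Q.obj ((ObjectProperty.ιOfLE hMD).obj B))
  map_id (A : M.FullSubcategory) : map (HoMor.ofHom S (𝟙 A.obj)).toClass = 𝟙 _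
  map_comp {A B E : M.FullSubcategory} (f : S.HoClass A.obj B.obj) (g : S.HoClass B.obj E.obj) :
    map (T.comp f g) = map f ≫ map g
  map_toClass {A B : M.FullSubcategory} (f : S.HoMor A.obj B.obj) (X : D.FullSubcategory)
    (p : X ⟶ (ObjectProperty.ιOfLE hMD).obj A) (q : X ⟶ (ObjectProperty.ιOfLE hMD).obj B)
    (h : (f.precomp p.hom).toClass = (HoMor.ofHom S q.hom).toClass) :
    (S.weqOn D).Q.map p ≫ map f.toClass = (S.weqOn D).Q.map q

/-- The underlying functor. -/
def PiH.InducedFunctor.toFunctor {M D : ObjectProperty (Diagram C)} {T : S.PiH M} {hMD : M ≤ D}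
    (Φ : T.InducedFunctor hMD) : T.Carrier ⥤ (S.weqOn D).Localization where
  obj (A : M.FullSubcategory) := (S.weqOn D).Q.obj ((ObjectProperty.ιOfLE hMD).obj A)
  map f := Φ.map f
  map_id A := Φ.map_id A
  map_comp f g := Φ.map_comp f g

end PDiagram

/-! ### Cartan-Eilenberg categories -/

section CartanEilenberg

variable {K : Type u} [Category.{v} K] (S W : MorphismProperty K)

/-- `N` is Cartan-Eilenberg cofibrant in `(K, S, W)`: every `w : Y ⟶ X` in `W` induces a bijection
`K[S⁻¹](N, Y) → K[S⁻¹](N, X)`. -/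
def IsCECofibrant (N : K) : Prop :=
  ∀ ⦃Y X : K⦄ (f : Y ⟶ X), W f →
    Function.Bijective (fun g : S.Q.obj N ⟶ S.Q.obj Y => g ≫ S.Q.map f)

/-- `(K, S, W)` is a category with strong and weak equivalences: `S` is contained in the
saturation of `W`, the class of the morphisms that become invertible in `K[W⁻¹]`. -/
def IsStrongWeak : Prop := S.IsInvertedBy W.Q

variable {S W}

/-- `N` is a left model of `X`: there is a morphism `N ⟶ X` in `K[S⁻¹]` that becomes an isomorphism
in `K[W⁻¹]`. -/
def IsLeftModel (h : IsStrongWeak S W) (N X : K) : Prop :=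
  ∃ e : S.Q.obj N ⟶ S.Q.obj X, IsIso ((Localization.Construction.lift W.Q h).map e)

variable (S W)

/-- `(K, S, W)` is a left Cartan-Eilenberg category: a category with strong and weak equivalences
in which every object has a Cartan-Eilenberg cofibrant left model. -/
def IsLeftCartanEilenberg : Prop :=
  ∃ h : IsStrongWeak S W, ∀ X : K, ∃ N : K, IsCECofibrant S W N ∧ IsLeftModel h N X

/-- `M` is a full subcategory of cofibrant models of `(K, S, W)`: its objects are
Cartan-Eilenberg cofibrant, and every object of `K` has a left model in `M`. -/
def IsSubcategoryOfCofibrantModels (M : ObjectProperty K) : Prop :=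
  ∃ h : IsStrongWeak S W,
    (∀ N : K, M N → IsCECofibrant S W N) ∧ ∀ X : K, ∃ N : K, M N ∧ IsLeftModel h N X

end CartanEilenberg

end HoDiagrams

/-! A ho-morphism f : A ⇝ B is replaced by a span of genuine morphisms A ← 𝓟(f) → B through its
mapping path. The left leg p (`mpFst`) is a level-wise trivial fibration and also a ho-equivalence.
The right leg q (`mpTgt`) commutes strictly with the comparison morphisms because the degree is
binary: it is f_i π₁ in degree 0 and the end of the path in degree 1. Moreover f = q s for a
ho-section s of p, and q is a level-wise weak equivalence if f is.

For a level-wise cofibrant N, ho-morphisms and homotopies lift along level-wise trivial fibrations,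
so [N, -]^h sends these to bijections; factoring through a path fibration gives the same for all of
𝓦 (`post_bijective_of_weq`). Hence x in [N, A]^h and f : A ⇝ B have a composite: lift x along p,
then apply q. This composition is associative and unital, agrees with every concatenation g * f, and
shows that [N, -]^h inverts 𝓗 as well.

Conversely, any functor L on 𝓓 that inverts the legs p sends f to L(q) L(p)⁻¹ (`realize`). This
respects homotopy, although P(B) need not lie in 𝓓: P(B) maps to a twice iterated mapping path,
which replaces it (`exists_path_to_object`).

If 𝓓[T⁻¹] inverts all p and [N, -]^h inverts T, a Yoneda argument identifies [N, B]^h with the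
morphisms N ⟶ B of 𝓓[T⁻¹] (`realizeClass_bijective`). With T = 𝓗 this makes N Cartan-Eilenberg
cofibrant, since [N, -]^h inverts 𝓦. With T = 𝓦 it makes Φ fully faithful and, by testing on objects
of 𝓜, shows that 𝓗 becomes invertible in Ho(𝓓). Models and essential surjectivity come from
realizing the weak equivalences N ⇝ X. -/

namespace HoDiagrams

/-! ### The structure maps of a functorial path, with identity functors unfolded -/

section Path

variable {C : Type u} [Category.{v} C]

namespace FunctorialPath

variable (T : FunctorialPath C)

/-- The constant path `A ⟶ P(A)`. -/
def inc (A : C) : A ⟶ T.P.obj A := T.ι.app A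

/-- The source `δ₀ : P(A) ⟶ A`. -/
def src (A : C) : T.P.obj A ⟶ A := T.δ₀.app A

/-- The target `δ₁ : P(A) ⟶ A`. -/
def tgt (A : C) : T.P.obj A ⟶ A := T.δ₁.app A

@[simp]
lemma inc_src (A : C) : T.inc A ≫ T.src A = 𝟙 A := T.ι_δ₀ A

@[simp]
lemma inc_src_assoc (A : C) {Z : C} (h : _ ⟶ Z) :
    T.inc A ≫ T.src A ≫ h = h :=
  (reassoc_of% (T.inc_src A)) h

@[simp]
lemma inc_tgt (A : C) : T.inc A ≫ T.tgt A = 𝟙 A := T.ι_δ₁ A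

@[simp]
lemma inc_tgt_assoc (A : C) {Z : C} (h : _ ⟶ Z) :
    T.inc A ≫ T.tgt A ≫ h = h :=
  (reassoc_of% (T.inc_tgt A)) h

lemma inc_map {A B : C} (f : A ⟶ B) : T.inc A ≫ T.P.map f = f ≫ T.inc B :=
  (T.ι.naturality f).symm

lemma inc_map_assoc {A B : C} (f : A ⟶ B) {Z : C} (h : _ ⟶ Z) :
    T.inc A ≫ T.P.map f ≫ h = f ≫ T.inc B ≫ h :=
  (reassoc_of% (T.inc_map f)) h

lemma map_src {A B : C} (f : A ⟶ B) : T.P.map f ≫ T.src B = T.src A ≫ f := T.δ₀.naturality f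

lemma map_src_assoc {A B : C} (f : A ⟶ B) {Z : C} (h : _ ⟶ Z) :
    T.P.map f ≫ T.src B ≫ h = T.src A ≫ f ≫ h :=
  (reassoc_of% (T.map_src f)) h

lemma map_tgt {A B : C} (f : A ⟶ B) : T.P.map f ≫ T.tgt B = T.tgt A ≫ f := T.δ₁.naturality f

end FunctorialPath

namespace StructuredPath

variable (T : StructuredPath C)

/-- The symmetry. -/
def sym (A : C) : T.P.obj A ⟶ T.P.obj A := T.τ.app A

/-- The interchange. -/
def itc (A : C) : T.P.obj (T.P.obj A) ⟶ T.P.obj (T.P.obj A) := T.μ.hom.app A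

/-- The coproduct. -/
def conn (A : C) : T.P.obj A ⟶ T.P.obj (T.P.obj A) := T.c.app A

/-- The folding map. -/
def fld (A : C) : T.P.obj (T.P.obj A) ⟶ T.P.obj A := T.fold.app A

@[simp]
lemma sym_sym (A : C) : T.sym A ≫ T.sym A = 𝟙 _ := T.τ_τ A

@[simp]
lemma inc_sym (A : C) : T.inc A ≫ T.sym A = T.inc A := T.ι_τ A

@[simp]
lemma inc_sym_assoc (A : C) {Z : C} (h : _ ⟶ Z) :
    T.inc A ≫ T.sym A ≫ h = T.inc A ≫ h :=
  (reassoc_of% (T.inc_sym A)) h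

@[simp]
lemma sym_src (A : C) : T.sym A ≫ T.src A = T.tgt A := T.τ_δ₀ A

@[simp]
lemma sym_src_assoc (A : C) {Z : C} (h : _ ⟶ Z) :
    T.sym A ≫ T.src A ≫ h = T.tgt A ≫ h :=
  (reassoc_of% (T.sym_src A)) h

@[simp]
lemma sym_tgt (A : C) : T.sym A ≫ T.tgt A = T.src A := T.τ_δ₁ A

@[simp]
lemma sym_tgt_assoc (A : C) {Z : C} (h : _ ⟶ Z) :
    T.sym A ≫ T.tgt A ≫ h = T.src A ≫ h :=
  (reassoc_of% (T.sym_tgt A)) h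

lemma map_sym {A B : C} (f : A ⟶ B) : T.P.map f ≫ T.sym B = T.sym A ≫ T.P.map f :=
  T.τ.naturality f

lemma map_sym_assoc {A B : C} (f : A ⟶ B) {Z : C} (h : _ ⟶ Z) :
    T.P.map f ≫ T.sym B ≫ h = T.sym A ≫ T.P.map f ≫ h :=
  (reassoc_of% (T.map_sym f)) h

@[simp]
lemma itc_src (A : C) : T.itc A ≫ T.src (T.P.obj A) = T.P.map (T.src A) := T.μ_δ₀ A

@[simp]
lemma itc_tgt (A : C) : T.itc A ≫ T.tgt (T.P.obj A) = T.P.map (T.tgt A) := T.μ_δ₁ A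

@[simp]
lemma itc_map_src (A : C) : T.itc A ≫ T.P.map (T.src A) = T.src (T.P.obj A) := T.μ_P_δ₀ A

@[simp]
lemma itc_map_tgt (A : C) : T.itc A ≫ T.P.map (T.tgt A) = T.tgt (T.P.obj A) := T.μ_P_δ₁ A

@[simp]
lemma inc_conn (A : C) : T.inc A ≫ T.conn A = T.inc A ≫ T.inc (T.P.obj A) := T.ι_c A

@[simp]
lemma inc_conn_assoc (A : C) {Z : C} (h : _ ⟶ Z) :
    T.inc A ≫ T.conn A ≫ h = T.inc A ≫ T.inc (T.P.obj A) ≫ h :=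
  (reassoc_of% (T.inc_conn A)) h

@[simp]
lemma conn_src (A : C) : T.conn A ≫ T.src (T.P.obj A) = T.src A ≫ T.inc A := T.c_δ₀ A

@[simp]
lemma conn_src_assoc (A : C) {Z : C} (h : _ ⟶ Z) :
    T.conn A ≫ T.src (T.P.obj A) ≫ h = T.src A ≫ T.inc A ≫ h :=
  (reassoc_of% (T.conn_src A)) h

@[simp]
lemma conn_tgt (A : C) : T.conn A ≫ T.tgt (T.P.obj A) = 𝟙 _ := T.c_δ₁ A

@[simp]
lemma conn_tgt_assoc (A : C) {Z : C} (h : _ ⟶ Z) :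
    T.conn A ≫ T.tgt (T.P.obj A) ≫ h = h :=
  (reassoc_of% (T.conn_tgt A)) h

@[simp]
lemma conn_map_src (A : C) : T.conn A ≫ T.P.map (T.src A) = T.src A ≫ T.inc A := T.c_P_δ₀ A

@[simp]
lemma conn_map_src_assoc (A : C) {Z : C} (h : _ ⟶ Z) :
    T.conn A ≫ T.P.map (T.src A) ≫ h = T.src A ≫ T.inc A ≫ h :=
  (reassoc_of% (T.conn_map_src A)) h

@[simp]
lemma conn_map_tgt (A : C) : T.conn A ≫ T.P.map (T.tgt A) = 𝟙 _ := T.c_P_δ₁ A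

@[simp]
lemma conn_map_tgt_assoc (A : C) {Z : C} (h : _ ⟶ Z) :
    T.conn A ≫ T.P.map (T.tgt A) ≫ h = h :=
  (reassoc_of% (T.conn_map_tgt A)) h

lemma map_conn {A B : C} (f : A ⟶ B) :
    T.P.map f ≫ T.conn B = T.conn A ≫ T.P.map (T.P.map f) := T.c.naturality f

lemma map_conn_assoc {A B : C} (f : A ⟶ B) {Z : C} (h : _ ⟶ Z) :
    T.P.map f ≫ T.conn B ≫ h = T.conn A ≫ T.P.map (T.P.map f) ≫ h :=
  (reassoc_of% (T.map_conn f)) h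

@[simp]
lemma fld_src (A : C) : T.fld A ≫ T.src A = T.src (T.P.obj A) ≫ T.src A := T.fold_δ₀ A

@[simp]
lemma fld_tgt (A : C) : T.fld A ≫ T.tgt A = T.tgt (T.P.obj A) ≫ T.tgt A := T.fold_δ₁ A

@[simp]
lemma inc_fld (A : C) : T.inc (T.P.obj A) ≫ T.fld A = 𝟙 _ := T.ι_fold A

/-- The coproduct reversed: the square with two constant sides at the target of a path. -/
def coconn (A : C) : T.P.obj A ⟶ T.P.obj (T.P.obj A) :=
  T.sym A ≫ T.conn A ≫ T.sym (T.P.obj A) ≫ T.P.map (T.sym A)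

@[simp]
lemma coconn_src (A : C) : T.coconn A ≫ T.src (T.P.obj A) = 𝟙 _ := by
  simp [coconn, T.map_src]

@[simp]
lemma coconn_tgt (A : C) : T.coconn A ≫ T.tgt (T.P.obj A) = T.tgt A ≫ T.inc A := by
  simp [coconn, T.map_tgt]

@[simp]
lemma coconn_map_src (A : C) : T.coconn A ≫ T.P.map (T.src A) = 𝟙 _ := by
  simp only [coconn, Category.assoc, ← Functor.map_comp, sym_src]
  simp [← T.map_sym]

@[simp]
lemma coconn_map_tgt (A : C) : T.coconn A ≫ T.P.map (T.tgt A) = T.tgt A ≫ T.inc A := by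
  simp only [coconn, Category.assoc, ← Functor.map_comp, sym_tgt]
  simp [← T.map_sym]

@[simp]
lemma inc_coconn (A : C) : T.inc A ≫ T.coconn A = T.inc A ≫ T.inc (T.P.obj A) := by
  simp [coconn, T.inc_map]

lemma map_coconn {A B : C} (f : A ⟶ B) :
    T.P.map f ≫ T.coconn B = T.coconn A ≫ T.P.map (T.P.map f) := by
  simp only [coconn, Category.assoc, map_sym_assoc, map_conn_assoc]
  simp only [← Functor.map_comp, map_sym]

/-- The square obtained from a square `H` by the substitution `(s, t) ↦ (t, s ∧ t)` of its
parameters. -/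
def turn (A : C) : T.P.obj (T.P.obj A) ⟶ T.P.obj (T.P.obj A) :=
  T.conn (T.P.obj A) ≫ T.P.map (T.fld A) ≫ T.itc A

/-- The sides of a turned square form a triangle: if the original square has sides α (by `src`) and
β (by `P(tgt)`), the new one has a constant side, then α, β, and the folded diagonal opposite to the
constant side. This is the filling needed to lift a ho-morphism to a mapping path in
`exists_lift_of_isConcat`. -/
lemma turn_src (A : C) :
    T.turn A ≫ T.src (T.P.obj A) = T.src (T.P.obj A) ≫ T.src A ≫ T.inc A := by
  simp only [turn, Category.assoc, itc_src]
  rw [← Functor.map_comp, fld_src, Functor.map_comp, conn_map_src_assoc, T.inc_map]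

lemma turn_tgt (A : C) : T.turn A ≫ T.tgt (T.P.obj A) = T.P.map (T.tgt A) := by
  simp only [turn, Category.assoc, itc_tgt]
  rw [← Functor.map_comp, fld_tgt, Functor.map_comp, conn_map_tgt_assoc]

lemma turn_map_src (A : C) : T.turn A ≫ T.P.map (T.src A) = T.src (T.P.obj A) := by
  simp only [turn, Category.assoc, itc_map_src, T.map_src]
  simp

lemma turn_map_tgt (A : C) : T.turn A ≫ T.P.map (T.tgt A) = T.fld A := by
  simp only [turn, Category.assoc, itc_map_tgt, T.map_tgt]
  simp

end StructuredPath

/-! ### P-categories -/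

namespace PCategory

variable [HasFiniteProducts C] (S : PCategory C)

/-- Trivial fibrations. -/
def TrivFib {A B : C} (f : A ⟶ B) : Prop := S.Fib f ∧ S.Weq f

variable {S}

lemma fib_comp' {A B E : C} {f : A ⟶ B} {g : B ⟶ E} (hf : S.Fib f) (hg : S.Fib g) :
    S.Fib (f ≫ g) :=
  S.fib_comp.comp_mem f g hf hg

lemma weq_comp {A B E : C} {f : A ⟶ B} {g : B ⟶ E} (hf : S.Weq f) (hg : S.Weq g) :
    S.Weq (f ≫ g) :=
  S.weq_twoOutOfThree.comp_mem f g hf hg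

lemma weq_of_weq_comp_right {A B E : C} {f : A ⟶ B} {g : B ⟶ E} (hg : S.Weq g)
    (hfg : S.Weq (f ≫ g)) : S.Weq f :=
  S.weq_twoOutOfThree.of_postcomp f g hg hfg

variable (S)

lemma trivFib_src (A : C) : S.TrivFib (S.src A) := ⟨S.fib_δ₀ A, S.weq_δ₀ A⟩

lemma trivFib_tgt (A : C) : S.TrivFib (S.tgt A) := ⟨S.fib_δ₁ A, S.weq_δ₁ A⟩

variable {S}

lemma TrivFib.comp {A B E : C} {f : A ⟶ B} {g : B ⟶ E} (hf : S.TrivFib f) (hg : S.TrivFib g) :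
    S.TrivFib (f ≫ g) :=
  ⟨fib_comp' hf.1 hg.1, weq_comp hf.2 hg.2⟩

lemma TrivFib.fst {A B X Y : C} {fst : Y ⟶ A} {snd : Y ⟶ B} {g : A ⟶ X} {p : B ⟶ X}
    (hp : S.TrivFib p) (sq : IsPullback fst snd g p) : S.TrivFib fst :=
  ⟨S.fib_fst sq hp.1, S.weq_fst sq hp.1 hp.2⟩

/-- The projection of a product to its second factor is a fibration. -/
lemma fib_prod_snd (A B : C) : S.Fib (prod.snd : A ⨯ B ⟶ B) := by
  have h : IsPullback (prod.snd : A ⨯ B ⟶ B) prod.fst (terminal.from B) (terminal.from A) :=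
    (IsPullback.of_hasBinaryProduct' A B).flip
  exact S.fib_fst h (S.fib_terminal A)

/-- The target map of the mapping path of any morphism `f` is a fibration. -/
lemma fib_snd_tgt {A B Y : C} {f : A ⟶ B} {fst : Y ⟶ A} {snd : Y ⟶ S.P.obj B}
    (sq : IsPullback fst snd f (S.src B)) : S.Fib (snd ≫ S.tgt B) := by
  -- The mapping path is also the pullback of (δ₀, δ₁) along f × 1, so its map to A × B is a
  -- fibration; it remains to project to B.
  have h : IsPullback (prod.lift fst (snd ≫ S.tgt B)) snd (prod.map f (𝟙 B))
      (prod.lift (S.src B) (S.tgt B)) := by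
    refine ⟨⟨?_⟩, ⟨PullbackCone.IsLimit.mk _ (fun s => sq.lift (s.fst ≫ prod.fst) s.snd ?_)
      ?_ ?_ ?_⟩⟩
    · ext <;> simp [prod.lift_fst, prod.lift_snd, sq.w]
    · have := s.condition =≫ prod.fst
      simpa [prod.lift_fst, prod.lift_snd] using this
    · intro s
      have := s.condition =≫ prod.snd
      ext <;> simp_all [prod.lift_fst, prod.lift_snd]
    · intro s; simp
    · intro s m h₁ h₂
      apply sq.hom_ext
      · simp [prod.lift_fst, ← h₁]
      · simp [← h₂]
  have := fib_comp' (S.fib_fst h (S.fib_δ B)) (fib_prod_snd A B)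
  simpa [prod.lift_fst, prod.lift_snd] using this

lemma fib_path {A B Y : C} (p : A ⟶ B) (hp : S.Fib p) {fst : Y ⟶ A ⨯ A} {snd : Y ⟶ S.P.obj B}
    (sq : IsPullback fst snd (prod.map p p) (prod.lift (S.src B) (S.tgt B)))
    (r : S.P.obj A ⟶ Y) (hr₁ : r ≫ fst = prod.lift (S.src A) (S.tgt A))
    (hr₂ : r ≫ snd = S.P.map p) : S.Fib r :=
  S.fib_double p hp sq r hr₁ hr₂

/-- Homotopies can be lifted along a trivial fibration `p`, with given end points: if
`V = Y ×_X P(X) ×_X Y`, then `P(Y) ⟶ V` is a trivial fibration. -/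
lemma trivFib_path {X Y V₁ V : C} {p : Y ⟶ X} (hp : S.TrivFib p) {a : V₁ ⟶ S.P.obj X}
    {b : V₁ ⟶ Y} (sq₁ : IsPullback a b (S.src X) p) {d : V ⟶ V₁} {e : V ⟶ Y}
    (sq : IsPullback d e (a ≫ S.tgt X) p) (r : S.P.obj Y ⟶ V)
    (hr₁ : r ≫ d ≫ b = S.src Y) (hr₂ : r ≫ d ≫ a = S.P.map p) (hr₃ : r ≫ e = S.tgt Y) :
    S.TrivFib r := by
  constructor
  -- The iterated fibre product V is the double mapping path of (p, p), so (P5) applies to r.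
  · refine fib_path p hp.1 (fst := prod.lift (d ≫ b) e) (snd := d ≫ a) ?_ r ?_ ?_
    · refine ⟨⟨?_⟩, ⟨PullbackCone.IsLimit.mk _ (fun s => sq.lift (sq₁.lift s.snd (s.fst ≫ prod.fst)
        ?_) (s.fst ≫ prod.snd) ?_) ?_ ?_ ?_⟩⟩
      · have h₁ := sq₁.w
        have h₂ := sq.w
        ext
        · simp [prod.lift_fst, h₁]
        · simpa [prod.lift_fst, prod.lift_snd] using h₂.symm
      · have := s.condition =≫ prod.fst
        simpa [prod.lift_fst, prod.lift_snd] using this.symm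
      · have := s.condition =≫ prod.snd
        rw [sq₁.lift_fst_assoc]
        simpa [prod.lift_fst, prod.lift_snd] using this.symm
      · intro s
        ext <;> simp [prod.lift_fst, prod.lift_snd]
      · intro s; simp
      · intro s m h₁ h₂
        apply sq.hom_ext
        · apply sq₁.hom_ext
          · simp [← h₂]
          · simp [prod.lift_fst, prod.lift_snd, ← h₁]
        · simp [prod.lift_fst, prod.lift_snd, ← h₁]
    · ext
      · simpa [prod.lift_fst, prod.lift_snd] using hr₁
      · simpa [prod.lift_fst, prod.lift_snd] using hr₃
    · exact hr₂
  -- Both projections d and a are pulled back from p, hence are weak equivalences, and their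
  -- composite with r is P(p); two out of three gives r.
  · have h₁ := hp.fst sq
    have h₂ := hp.fst sq₁
    refine weq_of_weq_comp_right (weq_comp h₁.2 h₂.2) ?_
    rw [hr₂]
    exact S.weq_map _ hp.2

/-- Homotopies from a cofibrant object can be lifted along a trivial fibration, with given
end points. -/
lemma IsCofibrant.exists_path_lift {N X Y : C} (hN : S.IsCofibrant N) {p : Y ⟶ X}
    (hp : S.TrivFib p) (h : N ⟶ S.P.obj X) (x y : N ⟶ Y) (hx : h ≫ S.src X = x ≫ p)
    (hy : h ≫ S.tgt X = y ≫ p) :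
    ∃ k : N ⟶ S.P.obj Y, k ≫ S.src Y = x ∧ k ≫ S.tgt Y = y ∧ k ≫ S.P.map p = h := by
  have := S.hasPullback (S.src X) p hp.1
  have sq₁ := IsPullback.of_hasPullback (S.src X) p
  set a := pullback.fst (S.src X) p
  set b := pullback.snd (S.src X) p
  have := S.hasPullback (a ≫ S.tgt X) p hp.1
  have sq := IsPullback.of_hasPullback (a ≫ S.tgt X) p
  set d := pullback.fst (a ≫ S.tgt X) p
  set e := pullback.snd (a ≫ S.tgt X) p
  let r₁ := sq₁.lift (S.P.map p) (S.src Y) (S.map_src _)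
  let r := sq.lift r₁ (S.tgt Y) (by simp [r₁, S.map_tgt])
  have hr : S.TrivFib r := trivFib_path hp sq₁ sq r (by simp [r, r₁]) (by simp [r, r₁])
    (by simp [r])
  obtain ⟨k, hk⟩ := hN r hr.1 hr.2 (sq.lift (sq₁.lift h x hx) y (by simpa using hy))
  refine ⟨k, ?_, ?_, ?_⟩
  · simpa [r, r₁] using hk =≫ (d ≫ b)
  · simpa [r, r₁] using hk =≫ e
  · simpa [r, r₁] using hk =≫ (d ≫ a)

/-- Two composable paths `α`, `β` from a cofibrant object are two sides of a square. -/
lemma IsCofibrant.exists_square {X E : C} (hX : S.IsCofibrant X) (α β : X ⟶ S.P.obj E)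
    (h : α ≫ S.tgt E = β ≫ S.src E) :
    ∃ L : X ⟶ S.P.obj (S.P.obj E),
      L ≫ S.src (S.P.obj E) = α ∧ L ≫ S.P.map (S.tgt E) = β := by
  have ht := S.trivFib_tgt E
  have := S.hasPullback (S.src E) (S.tgt E) ht.1
  have sq₁ := IsPullback.of_hasPullback (S.src E) (S.tgt E)
  set a := pullback.fst (S.src E) (S.tgt E)
  set b := pullback.snd (S.src E) (S.tgt E)
  have := S.hasPullback (a ≫ S.tgt E) (S.tgt E) ht.1
  have sq := IsPullback.of_hasPullback (a ≫ S.tgt E) (S.tgt E)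
  set d := pullback.fst (a ≫ S.tgt E) (S.tgt E)
  set e := pullback.snd (a ≫ S.tgt E) (S.tgt E)
  -- `trivFib_path` is used for the trivial fibration `tgt` itself: r sends a square to three of its
  -- sides. Forgetting the third is again a trivial fibration, and the two sides left are the
  -- prescribed ones.
  let r₁ := sq₁.lift (S.P.map (S.tgt E)) (S.src (S.P.obj E)) (S.map_src _)
  let r := sq.lift r₁ (S.tgt (S.P.obj E)) (by simp [r₁, S.map_tgt])
  have hr : S.TrivFib r := trivFib_path ht sq₁ sq r (by simp [r, r₁]) (by simp [r, r₁])
    (by simp [r])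
  have hd := ht.fst sq
  have hrd : S.TrivFib (r ≫ d) := hr.comp hd
  obtain ⟨L, hL⟩ := hX (r ≫ d) hrd.1 hrd.2 (sq₁.lift β α h.symm)
  have hr' : r ≫ d = r₁ := by simp [r]
  rw [hr'] at hL
  refine ⟨L, ?_, ?_⟩
  · simpa [r₁] using hL =≫ b
  · simpa [r₁] using hL =≫ a

end PCategory

end Path

/-! ### Generalities on diagrams and ho-morphisms -/

section DiagramBasics

variable {I : Type w} [Category.{w} I] {C : I ⥤ Cat.{v, u}}

namespace Diagram

@[simp]
lemma comp_app {A B E : Diagram C} (f : A ⟶ B) (g : B ⟶ E) (i : I) :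
    (f ≫ g).app i = f.app i ≫ g.app i := rfl

@[simp]
lemma id_app (A : Diagram C) (i : I) : Hom.app (𝟙 A) i = 𝟙 (A.obj i) := rfl

lemma hom_ext {A B : Diagram C} {f g : A ⟶ B} (h : ∀ i, f.app i = g.app i) : f = g :=
  Hom.ext (funext h)

lemma comm {A B : Diagram C} (f : A ⟶ B) {i j : I} (a : i ⟶ j) (ha : NonIdentity a) :
    A.φ a ha ≫ f.app j = (push C a).map (f.app i) ≫ B.φ a ha :=
  Hom.comm f a ha

lemma comm_assoc {A B : Diagram C} (f : A ⟶ B) {i j : I} (a : i ⟶ j) (ha : NonIdentity a)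
    {Z : C.obj j} (h : B.obj j ⟶ Z) :
    A.φ a ha ≫ f.app j ≫ h = (push C a).map (f.app i) ≫ B.φ a ha ≫ h :=
  (reassoc_of% (comm f a ha)) h

/-- The levels of an isomorphism of diagrams are mutually inverse. -/
lemma hom_inv_app {A B : Diagram C} (e : A ≅ B) (i : I) :
    e.hom.app i ≫ e.inv.app i = 𝟙 _ := by
  rw [← comp_app, e.hom_inv_id, id_app]

lemma inv_hom_app {A B : Diagram C} (e : A ≅ B) (i : I) :
    e.inv.app i ≫ e.hom.app i = 𝟙 _ := by
  rw [← comp_app, e.inv_hom_id, id_app]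

lemma isIso_app {A B : Diagram C} (e : A ≅ B) (i : I) : IsIso (e.hom.app i) :=
  ⟨e.inv.app i, hom_inv_app e i, inv_hom_app e i⟩

end Diagram

variable [∀ i, HasFiniteProducts (C.obj i)]

namespace PDiagram

/-! ### Compatibility of a_* with the functorial path -/

section Swap

variable (S : PDiagram C) {i j : I} (a : i ⟶ j)

/-- The comparison isomorphism `a_* P ⟶ P a_*`. -/
def swap (X : C.obj i) :
    (push C a).obj ((S.pcat i).P.obj X) ⟶ (S.pcat j).P.obj ((push C a).obj X) :=
  (S.pathIso a).inv.app X

lemma map_map_swap {X Y : C.obj i} (f : X ⟶ Y) :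
    (push C a).map ((S.pcat i).P.map f) ≫ S.swap a Y =
      S.swap a X ≫ (S.pcat j).P.map ((push C a).map f) :=
  (S.pathIso a).inv.naturality f

lemma pathIso_inv_hom (X : C.obj i) : S.swap a X ≫ (S.pathIso a).hom.app X = 𝟙 _ :=
  (S.pathIso a).inv_hom_id_app X

lemma swap_src (X : C.obj i) :
    S.swap a X ≫ (S.pcat j).src ((push C a).obj X) = (push C a).map ((S.pcat i).src X) := by
  have h : (S.pathIso a).hom.app X ≫ (push C a).map ((S.pcat i).src X) =
    (S.pcat j).src ((push C a).obj X) := S.pathIso_δ₀ a X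
  rw [← h, ← Category.assoc]
  erw [pathIso_inv_hom]
  exact Category.id_comp _

lemma swap_tgt (X : C.obj i) :
    S.swap a X ≫ (S.pcat j).tgt ((push C a).obj X) = (push C a).map ((S.pcat i).tgt X) := by
  have h : (S.pathIso a).hom.app X ≫ (push C a).map ((S.pcat i).tgt X) =
    (S.pcat j).tgt ((push C a).obj X) := S.pathIso_δ₁ a X
  rw [← h, ← Category.assoc]
  erw [pathIso_inv_hom]
  exact Category.id_comp _

lemma map_inc_swap (X : C.obj i) :
    (push C a).map ((S.pcat i).inc X) ≫ S.swap a X = (S.pcat j).inc ((push C a).obj X) := by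
  have h : (S.pcat j).inc ((push C a).obj X) ≫ (S.pathIso a).hom.app X =
    (push C a).map ((S.pcat i).inc X) := S.pathIso_ι a X
  rw [← h, Category.assoc]
  erw [(S.pathIso a).hom_inv_id_app X]
  exact Category.comp_id _

lemma map_inc_swap_assoc (X : C.obj i) {Z : C.obj j} (h : (S.pcat j).P.obj _ ⟶ Z) :
    (push C a).map ((S.pcat i).inc X) ≫ S.swap a X ≫ h =
      (S.pcat j).inc ((push C a).obj X) ≫ h :=
  (reassoc_of% (S.map_inc_swap a X)) h

lemma swap_src_assoc (X : C.obj i) {Z : C.obj j} (h : _ ⟶ Z) :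
    S.swap a X ≫ (S.pcat j).src ((push C a).obj X) ≫ h =
      (push C a).map ((S.pcat i).src X) ≫ h :=
  (reassoc_of% (S.swap_src a X)) h

lemma swap_tgt_assoc (X : C.obj i) {Z : C.obj j} (h : _ ⟶ Z) :
    S.swap a X ≫ (S.pcat j).tgt ((push C a).obj X) ≫ h =
      (push C a).map ((S.pcat i).tgt X) ≫ h :=
  (reassoc_of% (S.swap_tgt a X)) h

lemma map_map_swap_assoc {X Y : C.obj i} (f : X ⟶ Y) {Z : C.obj j}
    (h : (S.pcat j).P.obj _ ⟶ Z) :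
    (push C a).map ((S.pcat i).P.map f) ≫ S.swap a Y ≫ h =
      S.swap a X ≫ (S.pcat j).P.map ((push C a).map f) ≫ h :=
  (reassoc_of% (S.map_map_swap a f)) h

end Swap

variable (S : PDiagram C)

/-- The morphism `ι : B ⟶ P(B)` of diagrams. -/
def pathι (B : Diagram C) : B ⟶ S.path B where
  app i := (S.pcat i).inc (B.obj i)
  comm {i j} a ha := by
    change B.φ a ha ≫ (S.pcat j).inc (B.obj j) =
      (push C a).map ((S.pcat i).inc (B.obj i)) ≫ S.swap a (B.obj i) ≫ (S.pcat j).P.map (B.φ a ha)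
    rw [map_inc_swap_assoc, ← FunctorialPath.inc_map]

/-- The morphism `P(f) : P(A) ⟶ P(B)` of diagrams. -/
def pathMap {A B : Diagram C} (f : A ⟶ B) : S.path A ⟶ S.path B where
  app i := (S.pcat i).P.map (f.app i)
  comm {i j} a ha := by
    change (S.swap a (A.obj i) ≫ (S.pcat j).P.map (A.φ a ha)) ≫ (S.pcat j).P.map (f.app j) =
      (push C a).map ((S.pcat i).P.map (f.app i)) ≫ S.swap a (B.obj i) ≫ (S.pcat j).P.map (B.φ a ha)
    rw [map_map_swap_assoc, ← (S.pcat j).P.map_comp, ← Diagram.comm f a ha,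
      (S.pcat j).P.map_comp, Category.assoc]

lemma pathι_δ₀ (B : Diagram C) : S.pathι B ≫ S.pathδ₀ B = 𝟙 B :=
  Diagram.hom_ext fun i => (S.pcat i).inc_src (B.obj i)

lemma pathι_δ₁ (B : Diagram C) : S.pathι B ≫ S.pathδ₁ B = 𝟙 B :=
  Diagram.hom_ext fun i => (S.pcat i).inc_tgt (B.obj i)

lemma pathMap_δ₀ {A B : Diagram C} (f : A ⟶ B) : S.pathMap f ≫ S.pathδ₀ B = S.pathδ₀ A ≫ f :=
  Diagram.hom_ext fun i => (S.pcat i).map_src (f.app i)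

lemma pathMap_δ₁ {A B : Diagram C} (f : A ⟶ B) : S.pathMap f ≫ S.pathδ₁ B = S.pathδ₁ A ≫ f :=
  Diagram.hom_ext fun i => (S.pcat i).map_tgt (f.app i)

variable {S}

/-! ### Calculus of ho-morphisms and morphisms -/

namespace HoMor

variable {A B E F : Diagram C}

lemma htpy_src (f : S.HoMor A B) {i j : I} (a : i ⟶ j) (ha : NonIdentity a) :
    f.htpy a ha ≫ (S.pcat j).src (B.obj j) = A.φ a ha ≫ f.app j := f.htpy_δ₀ a ha

lemma htpy_tgt (f : S.HoMor A B) {i j : I} (a : i ⟶ j) (ha : NonIdentity a) :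
    f.htpy a ha ≫ (S.pcat j).tgt (B.obj j) = (push C a).map (f.app i) ≫ B.φ a ha :=
  f.htpy_δ₁ a ha

lemma htpy_src_assoc (f : S.HoMor A B) {i j : I} (a : i ⟶ j) (ha : NonIdentity a)
    {Z : C.obj j} (h : B.obj j ⟶ Z) :
    f.htpy a ha ≫ (S.pcat j).src (B.obj j) ≫ h = A.φ a ha ≫ f.app j ≫ h :=
  (reassoc_of% (f.htpy_src a ha)) h

lemma htpy_tgt_assoc (f : S.HoMor A B) {i j : I} (a : i ⟶ j) (ha : NonIdentity a)
    {Z : C.obj j} (h : B.obj j ⟶ Z) :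
    f.htpy a ha ≫ (S.pcat j).tgt (B.obj j) ≫ h =
      (push C a).map (f.app i) ≫ B.φ a ha ≫ h :=
  (reassoc_of% (f.htpy_tgt a ha)) h

lemma hext {f g : S.HoMor A B} (h₁ : ∀ i, f.app i = g.app i)
    (h₂ : ∀ ⦃i j : I⦄ (a : i ⟶ j) (ha : NonIdentity a), f.htpy a ha = g.htpy a ha) : f = g := by
  apply HoMor.ext
  · funext i; exact h₁ i
  · funext i j a ha; exact h₂ a ha

@[simp]
lemma ofHom_app (f : A ⟶ B) (i : I) : (ofHom S f).app i = f.app i := rfl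

lemma ofHom_htpy (f : A ⟶ B) {i j : I} (a : i ⟶ j) (ha : NonIdentity a) :
    (ofHom S f).htpy a ha = A.φ a ha ≫ f.app j ≫ (S.pcat j).inc (B.obj j) :=
  Category.assoc _ _ _

@[simp]
lemma precomp_app (f : S.HoMor B E) (g : A ⟶ B) (i : I) :
    (f.precomp g).app i = g.app i ≫ f.app i := rfl

@[simp]
lemma precomp_htpy (f : S.HoMor B E) (g : A ⟶ B) {i j : I} (a : i ⟶ j) (ha : NonIdentity a) :
    (f.precomp g).htpy a ha = (push C a).map (g.app i) ≫ f.htpy a ha := rfl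

@[simp]
lemma postcomp_app (f : S.HoMor A B) (g : B ⟶ E) (i : I) :
    (f.postcomp g).app i = f.app i ≫ g.app i := rfl

@[simp]
lemma postcomp_htpy (f : S.HoMor A B) (g : B ⟶ E) {i j : I} (a : i ⟶ j) (ha : NonIdentity a) :
    (f.postcomp g).htpy a ha = f.htpy a ha ≫ (S.pcat j).P.map (g.app j) := rfl

lemma postcomp_postcomp (f : S.HoMor A B) (g : B ⟶ E) (h : E ⟶ F) :
    (f.postcomp g).postcomp h = f.postcomp (g ≫ h) :=
  hext (fun i => by simp) (fun i j a ha => by simp)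

lemma precomp_precomp (f : S.HoMor E F) (g : B ⟶ E) (h : A ⟶ B) :
    (f.precomp g).precomp h = f.precomp (h ≫ g) :=
  hext (fun i => by simp) (fun i j a ha => by simp)

lemma precomp_postcomp (f : S.HoMor B E) (g : A ⟶ B) (h : E ⟶ F) :
    (f.precomp g).postcomp h = (f.postcomp h).precomp g :=
  hext (fun i => by simp) (fun i j a ha => by simp)

@[simp]
lemma postcomp_id (f : S.HoMor A B) : f.postcomp (𝟙 B) = f :=
  hext (fun i => by simp) (fun i j a ha => by simp)

@[simp]
lemma precomp_id (f : S.HoMor A B) : f.precomp (𝟙 A) = f :=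
  hext (fun i => by simp) (fun i j a ha => by simp)

lemma ofHom_postcomp (f : A ⟶ B) (g : B ⟶ E) :
    (ofHom S f).postcomp g = ofHom S (f ≫ g) :=
  hext (fun i => by simp) (fun i j a ha => by
    simp [ofHom_htpy, FunctorialPath.inc_map])

lemma ofHom_precomp (f : B ⟶ E) (g : A ⟶ B) :
    (ofHom S f).precomp g = ofHom S (g ≫ f) :=
  hext (fun i => by simp) (fun i j a ha => by
    simp [ofHom_htpy, Diagram.comm_assoc])

end HoMor

/-! ### Homotopy classes and composition with morphisms -/

section Classes

variable {A A' B E F : Diagram C}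

lemma Homotopic.postcomp {f g : S.HoMor A B} (h : Homotopic f g) (k : B ⟶ E) :
    Homotopic (f.postcomp k) (g.postcomp k) := by
  obtain ⟨h, rfl, rfl⟩ := h
  refine ⟨h.postcomp (S.pathMap k), ?_, ?_⟩
  · rw [HoMor.postcomp_postcomp, HoMor.postcomp_postcomp, pathMap_δ₀]
  · rw [HoMor.postcomp_postcomp, HoMor.postcomp_postcomp, pathMap_δ₁]

lemma Homotopic.precomp {f g : S.HoMor B E} (h : Homotopic f g) (k : A ⟶ B) :
    Homotopic (f.precomp k) (g.precomp k) := by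
  obtain ⟨h, rfl, rfl⟩ := h
  exact ⟨h.precomp k, HoMor.precomp_postcomp _ _ _, HoMor.precomp_postcomp _ _ _⟩

lemma toClass_eq {f g : S.HoMor A B} (h : Homotopic f g) : f.toClass = g.toClass := Quot.sound h

lemma toClass_surjective (x : S.HoClass A B) : ∃ f : S.HoMor A B, f.toClass = x :=
  Quot.exists_rep x

/-- Composition of classes of ho-morphisms with a morphism. -/
def HoClass.post (k : B ⟶ E) : S.HoClass A B → S.HoClass A E :=
  Quot.map (fun f => f.postcomp k) fun _ _ h => h.postcomp k

/-- Composition of a morphism with classes of ho-morphisms. -/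
def HoClass.pre (k : A ⟶ B) : S.HoClass B E → S.HoClass A E :=
  Quot.map (fun f => f.precomp k) fun _ _ h => h.precomp k

@[simp]
lemma HoClass.post_toClass (k : B ⟶ E) (f : S.HoMor A B) :
    HoClass.post k f.toClass = (f.postcomp k).toClass := rfl

@[simp]
lemma HoClass.pre_toClass (k : A ⟶ B) (f : S.HoMor B E) :
    HoClass.pre k f.toClass = (f.precomp k).toClass := rfl

lemma HoClass.post_id (x : S.HoClass A B) : HoClass.post (𝟙 B) x = x := by
  obtain ⟨f, rfl⟩ := toClass_surjective x
  simp

lemma HoClass.post_post (k : B ⟶ E) (l : E ⟶ F) (x : S.HoClass A B) :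
    HoClass.post l (HoClass.post k x) = HoClass.post (k ≫ l) x := by
  obtain ⟨f, rfl⟩ := toClass_surjective x
  simp [HoMor.postcomp_postcomp]

end Classes

end PDiagram

end DiagramBasics

/-! ### Fibre products of diagrams, and lifting of ho-morphisms along trivial fibrations -/

namespace PDiagram

section Lifting

variable {I : Type w} [Category.{w} I] {C : I ⥤ Cat.{v, u}} [∀ i, HasFiniteProducts (C.obj i)]
  {S : PDiagram C}

variable (S) in
/-- Level-wise fibrations. -/
def fib : MorphismProperty (Diagram C) := fun _ _ f => ∀ i, (S.pcat i).Fib (f.app i)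

variable (S) in
/-- Level-wise trivial fibrations. -/
def trivFib : MorphismProperty (Diagram C) := fun _ _ f => ∀ i, (S.pcat i).TrivFib (f.app i)

lemma trivFib.fib {A B : Diagram C} {f : A ⟶ B} (hf : S.trivFib f) : S.fib f := fun i => (hf i).1

lemma trivFib.weq {A B : Diagram C} {f : A ⟶ B} (hf : S.trivFib f) : S.weq f := fun i => (hf i).2

/-- A level-wise fibre product of diagrams. -/
def LevelPullback {V A B X : Diagram C} (fst : V ⟶ A) (snd : V ⟶ B) (f : A ⟶ X) (p : B ⟶ X) :
    Prop :=
  ∀ i, IsPullback (fst.app i) (snd.app i) (f.app i) (p.app i)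

lemma exists_levelPullback {A B X : Diagram C} (f : A ⟶ X) (p : B ⟶ X) (hp : S.fib p) :
    ∃ (V : Diagram C) (fst : V ⟶ A) (snd : V ⟶ B), LevelPullback fst snd f p := by
  have hpb (i : I) : HasPullback (f.app i) (p.app i) := (S.pcat i).hasPullback _ _ (hp i)
  let V : Diagram C :=
    { obj i := pullback (f.app i) (p.app i)
      φ {i j} a ha := pullback.lift
        ((push C a).map (pullback.fst (f.app i) (p.app i)) ≫ A.φ a ha)
        ((push C a).map (pullback.snd (f.app i) (p.app i)) ≫ B.φ a ha) (by
          rw [Category.assoc, Category.assoc, Diagram.comm, Diagram.comm, ← Functor.map_comp_assoc,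
            pullback.condition, Functor.map_comp_assoc]) }
  let fst : V ⟶ A :=
    { app i := pullback.fst (f.app i) (p.app i)
      comm a ha := pullback.lift_fst _ _ _ }
  let snd : V ⟶ B :=
    { app i := pullback.snd (f.app i) (p.app i)
      comm a ha := pullback.lift_snd _ _ _ }
  exact ⟨V, fst, snd, fun i => IsPullback.of_hasPullback _ _⟩

namespace LevelPullback

variable {V A B X N : Diagram C} {fst : V ⟶ A} {snd : V ⟶ B} {f : A ⟶ X} {p : B ⟶ X}

lemma exists_lift (sq : LevelPullback fst snd f p) (a : N ⟶ A) (b : N ⟶ B) (h : a ≫ f = b ≫ p) :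
    ∃ r : N ⟶ V, r ≫ fst = a ∧ r ≫ snd = b := by
  have h' (i : I) : a.app i ≫ f.app i = b.app i ≫ p.app i := by
    rw [← Diagram.comp_app, h, Diagram.comp_app]
  refine ⟨{ app i := (sq i).lift (a.app i) (b.app i) (h' i), comm := ?_ }, ?_, ?_⟩
  · intro i j u hu
    apply (sq j).hom_ext
    · rw [Category.assoc, Category.assoc, (sq j).lift_fst, Diagram.comm, Diagram.comm,
        ← Functor.map_comp_assoc, (sq i).lift_fst]
    · rw [Category.assoc, Category.assoc, (sq j).lift_snd, Diagram.comm, Diagram.comm,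
        ← Functor.map_comp_assoc, (sq i).lift_snd]
  · exact Diagram.hom_ext fun i => (sq i).lift_fst _ _ _
  · exact Diagram.hom_ext fun i => (sq i).lift_snd _ _ _

/-- The homotopies of the lift take values in P(V_j). As p is a fibration, P preserves the fibre
product, so they are determined by those of a and b. -/
lemma exists_hoMor_lift (sq : LevelPullback fst snd f p) (hp : S.fib p) (a : S.HoMor N A) (b : S.HoMor N B)
    (h : a.postcomp f = b.postcomp p) :
    ∃ r : S.HoMor N V, r.postcomp fst = a ∧ r.postcomp snd = b := by
  have h₁ (i : I) : a.app i ≫ f.app i = b.app i ≫ p.app i := by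
    rw [← HoMor.postcomp_app, h, HoMor.postcomp_app]
  have h₂ {i j : I} (u : i ⟶ j) (hu : NonIdentity u) :
      a.htpy u hu ≫ (S.pcat j).P.map (f.app j) = b.htpy u hu ≫ (S.pcat j).P.map (p.app j) := by
    rw [← HoMor.postcomp_htpy, h, HoMor.postcomp_htpy]
  have sq' (j : I) := (S.pcat j).isPullback_map (sq j) (hp j)
  refine ⟨{ app i := (sq i).lift (a.app i) (b.app i) (h₁ i)
            htpy {i j} u hu := (sq' j).lift (a.htpy u hu) (b.htpy u hu) (h₂ u hu)
            htpy_δ₀ := ?_, htpy_δ₁ := ?_ }, ?_, ?_⟩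
  · intro i j u hu
    change _ ≫ (S.pcat j).src (V.obj j) = _
    apply (sq j).hom_ext
    · rw [Category.assoc, Category.assoc, (sq j).lift_fst, ← FunctorialPath.map_src,
        (sq' j).lift_fst_assoc, a.htpy_src]
    · rw [Category.assoc, Category.assoc, (sq j).lift_snd, ← FunctorialPath.map_src,
        (sq' j).lift_snd_assoc, b.htpy_src]
  · intro i j u hu
    change _ ≫ (S.pcat j).tgt (V.obj j) = _
    apply (sq j).hom_ext
    · rw [Category.assoc, Category.assoc, ← FunctorialPath.map_tgt,
        (sq' j).lift_fst_assoc, a.htpy_tgt, Diagram.comm, ← Functor.map_comp_assoc,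
        (sq i).lift_fst]
    · rw [Category.assoc, Category.assoc, ← FunctorialPath.map_tgt,
        (sq' j).lift_snd_assoc, b.htpy_tgt, Diagram.comm, ← Functor.map_comp_assoc,
        (sq i).lift_snd]
  · exact HoMor.hext (fun i => (sq i).lift_fst _ _ _)
      fun i j u hu => (sq' j).lift_fst _ _ _
  · exact HoMor.hext (fun i => (sq i).lift_snd _ _ _)
      fun i j u hu => (sq' j).lift_snd _ _ _

end LevelPullback

variable {N X Y E : Diagram C}

/-- Ho-morphisms from a level-wise cofibrant diagram lift along level-wise trivial fibrations. -/
lemma exists_lift_of_trivFib (hN : S.cof N) {p : Y ⟶ X} (hp : S.trivFib p) (f : S.HoMor N X) :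
    ∃ g : S.HoMor N Y, g.postcomp p = f := by
  have h₁ (i : I) := hN.1 i (p.app i) (hp i).1 (hp i).2 (f.app i)
  choose g hg using h₁
  -- The level-wise lifts g are chosen independently, so they fix the end points of the lifted
  -- homotopies. Cofibrancy of u_*(N_i) allows the homotopies to be lifted with these ends.
  have h₂ {i j : I} (u : i ⟶ j) (hu : NonIdentity u) :=
    (hN.2 u).exists_path_lift (hp j) (f.htpy u hu) (N.φ u hu ≫ g j)
      ((push C u).map (g i) ≫ Y.φ u hu) (by rw [f.htpy_src, Category.assoc, hg])
      (by rw [f.htpy_tgt, Category.assoc, Diagram.comm, ← Functor.map_comp_assoc, hg])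
  choose G hG₀ hG₁ hG using @h₂
  exact ⟨{ app := g, htpy := G, htpy_δ₀ := hG₀, htpy_δ₁ := hG₁ },
    HoMor.hext hg fun i j u hu => hG u hu⟩

/-- Homotopies from a level-wise cofibrant diagram lift along level-wise trivial fibrations, with
given end points. -/
lemma homotopic_of_trivFib (hN : S.cof N) {p : Y ⟶ X} (hp : S.trivFib p) (f g : S.HoMor N Y)
    (h : Homotopic (f.postcomp p) (g.postcomp p)) : Homotopic f g := by
  obtain ⟨h, hf, hg⟩ := h
  -- V = Y ×_X P(X) ×_X Y is formed in diagrams. The triple (f, h, g) is a ho-morphism to V, and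
  -- P(Y) ⟶ V is a level-wise trivial fibration, along which it lifts.
  obtain ⟨V₁, a, b, sq₁⟩ := exists_levelPullback (S.pathδ₀ X) p hp.fib
  obtain ⟨V, d, e, sq⟩ := exists_levelPullback (a ≫ S.pathδ₁ X) p hp.fib
  obtain ⟨r₁, hr₁, hr₁'⟩ := sq₁.exists_lift (S.pathMap p) (S.pathδ₀ Y) (S.pathMap_δ₀ p)
  obtain ⟨r, hr, hr'⟩ := sq.exists_lift r₁ (S.pathδ₁ Y) (by
    rw [← Category.assoc, hr₁, pathMap_δ₁])
  have hr_triv : S.trivFib r := fun i => by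
    refine PCategory.trivFib_path (hp i) (sq₁ i) (sq i) _ ?_ ?_ ?_
    · exact congrArg (fun k => Diagram.Hom.app k i)
        (show r ≫ d ≫ b = S.pathδ₀ Y by rw [← Category.assoc, hr, hr₁'])
    · exact congrArg (fun k => Diagram.Hom.app k i)
        (show r ≫ d ≫ a = S.pathMap p by rw [← Category.assoc, hr, hr₁])
    · exact congrArg (fun k => Diagram.Hom.app k i) hr'
  obtain ⟨k₁, hk₁, hk₁'⟩ := sq₁.exists_hoMor_lift hp.fib h f hf
  obtain ⟨k, hk, hk'⟩ := sq.exists_hoMor_lift hp.fib k₁ g (by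
    rw [← HoMor.postcomp_postcomp, hk₁, hg])
  obtain ⟨l, hl⟩ := exists_lift_of_trivFib hN hr_triv k
  refine ⟨l, ?_, ?_⟩
  · rw [← hr₁', ← hr, Category.assoc, ← HoMor.postcomp_postcomp, ← HoMor.postcomp_postcomp, hl,
      hk, hk₁']
  · rw [← hr', ← HoMor.postcomp_postcomp, hl, hk']

lemma Homotopic.refl (f : S.HoMor N X) : Homotopic f f :=
  ⟨f.postcomp (S.pathι X), by rw [HoMor.postcomp_postcomp, pathι_δ₀, HoMor.postcomp_id],
    by rw [HoMor.postcomp_postcomp, pathι_δ₁, HoMor.postcomp_id]⟩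

/-- Surjectivity is lifting of ho-morphisms. For injectivity, a chain of homotopies in X is lifted
link by link, each intermediate ho-morphism being lifted arbitrarily. -/
lemma post_bijective_of_trivFib (hN : S.cof N) {p : Y ⟶ X} (hp : S.trivFib p) :
    Function.Bijective (HoClass.post p : S.HoClass N Y → S.HoClass N X) := by
  constructor
  · intro x y hxy
    obtain ⟨f, rfl⟩ := toClass_surjective x
    obtain ⟨g, rfl⟩ := toClass_surjective y
    -- Quantifying over all lifts of both ends lets the induction pass through the intermediate
    -- lifts of the transitivity case.
    have key (x y : S.HoMor N X) (h : Relation.EqvGen Homotopic x y) :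
        ∀ f g : S.HoMor N Y, f.postcomp p = x → g.postcomp p = y → f.toClass = g.toClass := by
      induction h with
      | rel x y h =>
        rintro f g rfl rfl
        exact toClass_eq (homotopic_of_trivFib hN hp f g h)
      | refl x =>
        rintro f g rfl hg
        exact toClass_eq (homotopic_of_trivFib hN hp f g (hg ▸ Homotopic.refl _))
      | symm x y _ ih => exact fun f g hf hg => (ih g f hg hf).symm
      | trans x y z _ _ ih₁ ih₂ =>
        intro f g hf hg
        obtain ⟨k, hk⟩ := exists_lift_of_trivFib hN hp y
        exact (ih₁ f k hf hk).trans (ih₂ k g hk hg)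
    exact key _ _ (Quot.eqvGen_exact hxy) f g rfl rfl
  · intro x
    obtain ⟨f, rfl⟩ := toClass_surjective x
    obtain ⟨g, rfl⟩ := exists_lift_of_trivFib hN hp f
    exact ⟨g.toClass, rfl⟩

/-- Level-wise weak equivalences induce bijections on homotopy classes of ho-morphisms from a
level-wise cofibrant diagram. -/
lemma post_bijective_of_weq (hN : S.cof N) {f : Y ⟶ X} (hf : S.weq f) :
    Function.Bijective (HoClass.post f : S.HoClass N Y → S.HoClass N X) := by
  -- Brown's factorization f = q s with a s = 1, where a and q are trivial fibrations. E is built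
  -- from the diagram `S.path X` and its comparison morphisms P(φ), unlike `mappingPath`; it need
  -- not lie in any given subcategory.
  obtain ⟨E, a, b, sq⟩ := exists_levelPullback f (S.pathδ₀ X) fun i => (S.pcat i).fib_δ₀ _
  have ha : S.trivFib a := fun i => ((S.pcat i).trivFib_src _).fst (sq i)
  have hq : S.trivFib (b ≫ S.pathδ₁ X) := fun i =>
    ⟨PCategory.fib_snd_tgt (sq i), PCategory.weq_comp
      ((S.pcat i).weq_snd (sq i) ((S.pcat i).fib_δ₀ _) (hf i)) ((S.pcat i).weq_δ₁ _)⟩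
  obtain ⟨s, hs, hs'⟩ := sq.exists_lift (𝟙 Y) (f ≫ S.pathι X) (by
    rw [Category.id_comp, Category.assoc, pathι_δ₀, Category.comp_id])
  have h₁ : (HoClass.post a : S.HoClass N E → _) ∘ HoClass.post s = id :=
    funext fun x => by rw [Function.comp_apply, HoClass.post_post, hs, HoClass.post_id]; rfl
  have h₂ : (HoClass.post f : S.HoClass N Y → _) =
      HoClass.post (b ≫ S.pathδ₁ X) ∘ HoClass.post s :=
    funext fun x => by
      rw [Function.comp_apply, HoClass.post_post, ← Category.assoc, hs', Category.assoc, pathι_δ₁,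
        Category.comp_id]
  have hs_bij : Function.Bijective (HoClass.post s : S.HoClass N Y → S.HoClass N E) :=
    ((post_bijective_of_trivFib hN ha).of_comp_iff' _).1 (h₁ ▸ Function.bijective_id)
  rw [h₂]
  exact (post_bijective_of_trivFib hN hq).comp hs_bij

end Lifting

end PDiagram

/-! ### Mapping paths of ho-morphisms -/

/-- This makes it possible to define morphisms of diagrams by different formulas in the two degrees:
each commutation condition involves one level of each degree. -/
lemma BinaryDegree.source_target {I : Type w} [Category.{w} I] (d : BinaryDegree I) {i j : I}
    (a : i ⟶ j) (ha : NonIdentity a) : d.deg i = 0 ∧ d.deg j ≠ 0 := by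
  have := d.deg_lt a ha
  omega

namespace PDiagram

section MappingPath

variable {I : Type w} [Category.{w} I] {C : I ⥤ Cat.{v, u}} [∀ i, HasFiniteProducts (C.obj i)]
  {S : PDiagram C}

namespace HoMor

variable {A B : Diagram C} (f : S.HoMor A B)

/-- The projection of the mapping path of `f : A ⇝ B` to `A`. -/
noncomputable def mpFst : mappingPath f ⟶ A where
  app i :=
    have := S.hasPullback_mappingPath (f.app i)
    pullback.fst (f.app i) ((S.pcat i).δ₀.app (B.obj i))
  comm {i j} a ha :=
    have := S.hasPullback_mappingPath (f.app i)
    have := S.hasPullback_mappingPath (f.app j)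
    (Category.assoc _ _ _).trans (congrArg (fun k => (push C a).map (pullback.fst _ _) ≫ k)
      (pullback.lift_fst _ _ (f.htpy_δ₀ a ha).symm))

/-- The projection of the mapping path of `f : A ⇝ B` to the paths of `B`, at some level. -/
noncomputable def mpPath (i : I) : (mappingPath f).obj i ⟶ (S.pcat i).P.obj (B.obj i) :=
  have := S.hasPullback_mappingPath (f.app i)
  pullback.snd (f.app i) ((S.pcat i).δ₀.app (B.obj i))

lemma isPullback_mp (i : I) :
    IsPullback (f.mpFst.app i) (f.mpPath i) (f.app i) ((S.pcat i).src (B.obj i)) :=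
  have := S.hasPullback_mappingPath (f.app i)
  IsPullback.of_hasPullback (f.app i) ((S.pcat i).δ₀.app (B.obj i))

lemma φ_mpFst {i j : I} (a : i ⟶ j) (ha : NonIdentity a) :
    (mappingPath f).φ a ha ≫ f.mpFst.app j = (push C a).map (f.mpFst.app i) ≫ A.φ a ha :=
  Diagram.comm f.mpFst a ha

lemma φ_mpPath {i j : I} (a : i ⟶ j) (ha : NonIdentity a) :
    (mappingPath f).φ a ha ≫ f.mpPath j = (push C a).map (f.mpFst.app i) ≫ f.htpy a ha := by
  have := S.hasPullback_mappingPath (f.app i)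
  have := S.hasPullback_mappingPath (f.app j)
  exact (Category.assoc _ _ _).trans (congrArg (fun k => (push C a).map (pullback.fst _ _) ≫ k)
    (pullback.lift_snd _ _ (f.htpy_δ₀ a ha).symm))

lemma φ_mpFst_assoc {i j : I} (a : i ⟶ j) (ha : NonIdentity a) {Z : C.obj j}
    (h : A.obj j ⟶ Z) :
    (mappingPath f).φ a ha ≫ f.mpFst.app j ≫ h =
      (push C a).map (f.mpFst.app i) ≫ A.φ a ha ≫ h :=
  (reassoc_of% (f.φ_mpFst a ha)) h

lemma φ_mpPath_assoc {i j : I} (a : i ⟶ j) (ha : NonIdentity a) {Z : C.obj j}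
    (h : (S.pcat j).P.obj (B.obj j) ⟶ Z) :
    (mappingPath f).φ a ha ≫ f.mpPath j ≫ h =
      (push C a).map (f.mpFst.app i) ≫ f.htpy a ha ≫ h :=
  (reassoc_of% (f.φ_mpPath a ha)) h

lemma trivFib_mpFst : S.trivFib f.mpFst :=
  fun i => ((S.pcat i).trivFib_src _).fst (f.isPullback_mp i)

/-- The morphism from the mapping path of `f : A ⇝ B` to `B` given by the composition with `f` on
the levels of degree zero, and by the target of the path on the levels of degree one. -/
noncomputable def mpTgt (d : BinaryDegree I) : mappingPath f ⟶ B where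
  app i := if d.deg i = 0 then f.mpFst.app i ≫ f.app i
    else f.mpPath i ≫ (S.pcat i).tgt (B.obj i)
  comm {i j} a ha := by
    -- The comparison morphism forgets the path in degree 0 and inserts F_a in degree 1. Since F_a
    -- ends at φ_a a_*(f_i), the formula f_i π₁ is the one that fits in degree 0.
    rw [if_pos (d.source_target a ha).1, if_neg (d.source_target a ha).2, φ_mpPath_assoc,
      htpy_tgt, Functor.map_comp, Category.assoc]

variable {f} in
lemma mpTgt_app_of_eq {d : BinaryDegree I} {i : I} (hi : d.deg i = 0) :
    (f.mpTgt d).app i = f.mpFst.app i ≫ f.app i := if_pos hi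

variable {f} in
lemma mpTgt_app_of_ne {d : BinaryDegree I} {i : I} (hi : d.deg i ≠ 0) :
    (f.mpTgt d).app i = f.mpPath i ≫ (S.pcat i).tgt (B.obj i) := if_neg hi

variable {f} in
lemma weq_mpTgt (d : BinaryDegree I) (hf : f.IsWeq) : S.weq (f.mpTgt d) := by
  intro i
  by_cases hi : d.deg i = 0
  · rw [mpTgt_app_of_eq hi]
    exact PCategory.weq_comp (f.trivFib_mpFst i).2 (hf i)
  · rw [mpTgt_app_of_ne hi]
    exact PCategory.weq_comp ((S.pcat i).weq_snd (f.isPullback_mp i) ((S.pcat i).fib_δ₀ _) (hf i))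
      ((S.pcat i).weq_δ₁ _)

/-- Naturality of the span A ← 𝓟(f) → B in strictly commutative squares. It makes composition and
realization of ho-morphisms compatible with morphisms on either side. -/
lemma exists_mpMap (d : BinaryDegree I) {A' B' : Diagram C} (f' : S.HoMor A' B') (a : A' ⟶ A)
    (b : B' ⟶ B) (h : f'.postcomp b = f.precomp a) :
    ∃ r : mappingPath f' ⟶ mappingPath f,
      r ≫ f.mpFst = f'.mpFst ≫ a ∧ r ≫ f.mpTgt d = f'.mpTgt d ≫ b := by
  have h₁ (i : I) : f'.app i ≫ b.app i = a.app i ≫ f.app i := by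
    rw [← postcomp_app, h, precomp_app]
  have h₂ {i j : I} (u : i ⟶ j) (hu : NonIdentity u) :
      f'.htpy u hu ≫ (S.pcat j).P.map (b.app j) = (push C u).map (a.app i) ≫ f.htpy u hu := by
    rw [← postcomp_htpy, h, precomp_htpy]
  let r (i : I) : (mappingPath f').obj i ⟶ (mappingPath f).obj i :=
    (f.isPullback_mp i).lift (f'.mpFst.app i ≫ a.app i)
      (f'.mpPath i ≫ (S.pcat i).P.map (b.app i)) (by
        rw [Category.assoc, Category.assoc, FunctorialPath.map_src, ← h₁,
          ← (f'.isPullback_mp i).w_assoc])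
  have hr (i : I) : r i ≫ f.mpFst.app i = f'.mpFst.app i ≫ a.app i :=
    (f.isPullback_mp i).lift_fst _ _ _
  have hr' (i : I) : r i ≫ f.mpPath i = f'.mpPath i ≫ (S.pcat i).P.map (b.app i) :=
    (f.isPullback_mp i).lift_snd _ _ _
  refine ⟨{ app := r, comm := ?_ }, ?_, ?_⟩
  · intro i j u hu
    apply (f.isPullback_mp j).hom_ext
    · rw [Category.assoc, Category.assoc, hr, φ_mpFst_assoc, φ_mpFst, Diagram.comm,
        ← (push C u).map_comp_assoc (r i), hr, Functor.map_comp_assoc]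
    · rw [Category.assoc, Category.assoc, hr', φ_mpPath_assoc, φ_mpPath, h₂,
        ← (push C u).map_comp_assoc (r i), hr, Functor.map_comp_assoc]
  · exact Diagram.hom_ext hr
  · refine Diagram.hom_ext fun i => ?_
    change r i ≫ _ = _ ≫ _
    by_cases hi : d.deg i = 0
    · rw [mpTgt_app_of_eq hi, mpTgt_app_of_eq hi, Category.assoc, h₁, ← Category.assoc, hr,
        Category.assoc]
    · rw [mpTgt_app_of_ne hi, mpTgt_app_of_ne hi, ← Category.assoc, hr', Category.assoc,
        FunctorialPath.map_tgt, Category.assoc]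

lemma exists_mpMap_precomp (d : BinaryDegree I) {A' : Diagram C} (a : A' ⟶ A) :
    ∃ r : mappingPath (f.precomp a) ⟶ mappingPath f,
      r ≫ f.mpFst = (f.precomp a).mpFst ≫ a ∧ r ≫ f.mpTgt d = (f.precomp a).mpTgt d := by
  simpa using f.exists_mpMap d (f.precomp a) a (𝟙 B) (by simp)

lemma exists_mpMap_postcomp (d : BinaryDegree I) {B' : Diagram C} (b : B ⟶ B') :
    ∃ r : mappingPath f ⟶ mappingPath (f.postcomp b),
      r ≫ (f.postcomp b).mpFst = f.mpFst ∧ r ≫ (f.postcomp b).mpTgt d = f.mpTgt d ≫ b := by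
  simpa using (f.postcomp b).exists_mpMap d f (𝟙 A) b (by simp)

/-! ### Ho-morphisms into a mapping path -/

section Lift

variable {N : Diagram C} (x : S.HoMor N A)
  (γ : ∀ i, N.obj i ⟶ (S.pcat i).P.obj (B.obj i))
  (Γ : ∀ ⦃i j : I⦄ (a : i ⟶ j), NonIdentity a →
    ((push C a).obj (N.obj i) ⟶ (S.pcat j).P.obj ((S.pcat j).P.obj (B.obj j))))
  (hγ : ∀ i, γ i ≫ (S.pcat i).src (B.obj i) = x.app i ≫ f.app i)
  (hΓ : ∀ ⦃i j : I⦄ (a : i ⟶ j) (ha : NonIdentity a),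
    Γ a ha ≫ (S.pcat j).P.map ((S.pcat j).src (B.obj j)) =
      x.htpy a ha ≫ (S.pcat j).P.map (f.app j))
  (hΓ₀ : ∀ ⦃i j : I⦄ (a : i ⟶ j) (ha : NonIdentity a),
    Γ a ha ≫ (S.pcat j).src ((S.pcat j).P.obj (B.obj j)) = N.φ a ha ≫ γ j)
  (hΓ₁ : ∀ ⦃i j : I⦄ (a : i ⟶ j) (ha : NonIdentity a),
    Γ a ha ≫ (S.pcat j).tgt ((S.pcat j).P.obj (B.obj j)) =
      (push C a).map (x.app i) ≫ f.htpy a ha)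

lemma isPullback_map_mp (i : I) :
    IsPullback ((S.pcat i).P.map (f.mpFst.app i)) ((S.pcat i).P.map (f.mpPath i))
      ((S.pcat i).P.map (f.app i)) ((S.pcat i).P.map ((S.pcat i).src (B.obj i))) :=
  (S.pcat i).isPullback_map (f.isPullback_mp i) ((S.pcat i).fib_δ₀ _)

/-- The ho-morphism to the mapping path of `f : A ⇝ B` with the given components. -/
noncomputable def mpLift : S.HoMor N (mappingPath f) where
  app i := (f.isPullback_mp i).lift (x.app i) (γ i) (hγ i).symm
  htpy {_ j} a ha := (f.isPullback_map_mp j).lift (x.htpy a ha) (Γ a ha) (hΓ a ha).symm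
  htpy_δ₀ {i j} a ha := by
    change _ ≫ (S.pcat j).src ((mappingPath f).obj j) = _
    apply (f.isPullback_mp j).hom_ext
    · rw [Category.assoc, ← FunctorialPath.map_src, (f.isPullback_map_mp j).lift_fst_assoc,
        htpy_src, Category.assoc, (f.isPullback_mp j).lift_fst]
    · rw [Category.assoc, ← FunctorialPath.map_src, (f.isPullback_map_mp j).lift_snd_assoc,
        hΓ₀, Category.assoc, (f.isPullback_mp j).lift_snd]
  htpy_δ₁ {i j} a ha := by
    change _ ≫ (S.pcat j).tgt ((mappingPath f).obj j) = _
    apply (f.isPullback_mp j).hom_ext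
    · rw [Category.assoc, ← FunctorialPath.map_tgt, (f.isPullback_map_mp j).lift_fst_assoc,
        htpy_tgt, Category.assoc, φ_mpFst, ← Functor.map_comp_assoc,
        (f.isPullback_mp i).lift_fst]
    · rw [Category.assoc, ← FunctorialPath.map_tgt, (f.isPullback_map_mp j).lift_snd_assoc,
        hΓ₁, Category.assoc, φ_mpPath, ← Functor.map_comp_assoc,
        (f.isPullback_mp i).lift_fst]

lemma mpLift_app_mpFst (i : I) :
    (f.mpLift x γ Γ hγ hΓ hΓ₀ hΓ₁).app i ≫ f.mpFst.app i = x.app i :=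
  (f.isPullback_mp i).lift_fst _ _ _

lemma mpLift_app_mpPath (i : I) :
    (f.mpLift x γ Γ hγ hΓ hΓ₀ hΓ₁).app i ≫ f.mpPath i = γ i :=
  (f.isPullback_mp i).lift_snd _ _ _

lemma mpLift_htpy_mpFst {i j : I} (a : i ⟶ j) (ha : NonIdentity a) :
    (f.mpLift x γ Γ hγ hΓ hΓ₀ hΓ₁).htpy a ha ≫ (S.pcat j).P.map (f.mpFst.app j) =
      x.htpy a ha :=
  (f.isPullback_map_mp j).lift_fst _ _ _

lemma mpLift_htpy_mpPath {i j : I} (a : i ⟶ j) (ha : NonIdentity a) :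
    (f.mpLift x γ Γ hγ hΓ hΓ₀ hΓ₁).htpy a ha ≫ (S.pcat j).P.map (f.mpPath j) = Γ a ha :=
  (f.isPullback_map_mp j).lift_snd _ _ _

lemma mpLift_postcomp_mpFst : (f.mpLift x γ Γ hγ hΓ hΓ₀ hΓ₁).postcomp f.mpFst = x :=
  hext (fun i => f.mpLift_app_mpFst x γ Γ hγ hΓ hΓ₀ hΓ₁ i)
    fun _ _ a ha => f.mpLift_htpy_mpFst x γ Γ hγ hΓ hΓ₀ hΓ₁ a ha

/-- In degree 0 the target map sees f x, in degree 1 the ends of the paths γ; the homotopies are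
compared only at degree 1 levels, through the ends of Γ. -/
lemma mpLift_postcomp_mpTgt (d : BinaryDegree I) (k : S.HoMor N B)
    (hk : ∀ i, x.app i ≫ f.app i = k.app i)
    (hγk : ∀ i, γ i ≫ (S.pcat i).tgt (B.obj i) = k.app i)
    (hΓk : ∀ ⦃i j : I⦄ (a : i ⟶ j) (ha : NonIdentity a),
      Γ a ha ≫ (S.pcat j).P.map ((S.pcat j).tgt (B.obj j)) = k.htpy a ha) :
    (f.mpLift x γ Γ hγ hΓ hΓ₀ hΓ₁).postcomp (f.mpTgt d) = k := by
  refine hext (fun i => ?_) (fun i j a ha => ?_)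
  · rw [postcomp_app]
    by_cases hi : d.deg i = 0
    · rw [mpTgt_app_of_eq hi, ← Category.assoc, mpLift_app_mpFst, hk]
    · rw [mpTgt_app_of_ne hi, ← Category.assoc, mpLift_app_mpPath, hγk]
  · rw [postcomp_htpy, mpTgt_app_of_ne (d.source_target a ha).2, (S.pcat j).P.map_comp,
      ← Category.assoc, mpLift_htpy_mpPath, hΓk]

end Lift

/-- The ho-section of the projection of the mapping path of `f : A ⇝ B` to `A`. -/
noncomputable def mpSection : S.HoMor A (mappingPath f) :=
  f.mpLift (ofHom S (𝟙 A)) (fun i => f.app i ≫ (S.pcat i).inc (B.obj i))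
    -- The section consists of constant paths, whereas the mapping path inserts F_a. The coproduct
    -- applied to F_a is a path from the constant path at its start to F_a itself.
    (fun _ j a ha => f.htpy a ha ≫ (S.pcat j).conn (B.obj j)) (by simp)
    (fun i j a ha => by
      rw [Category.assoc, StructuredPath.conn_map_src, htpy_src_assoc, ofHom_htpy,
        Diagram.id_app, Category.id_comp, Category.assoc, FunctorialPath.inc_map])
    (fun i j a ha => by
      rw [Category.assoc, StructuredPath.conn_src, htpy_src_assoc])
    (fun i j a ha => by simp)

lemma mpSection_postcomp_mpFst : f.mpSection.postcomp f.mpFst = ofHom S (𝟙 A) :=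
  mpLift_postcomp_mpFst ..

/-- Because P(δ₁) c = 1, the homotopies F_a are recovered exactly, not only up to homotopy. This
yields the left unit law. -/
lemma mpSection_postcomp_mpTgt (d : BinaryDegree I) : f.mpSection.postcomp (f.mpTgt d) = f :=
  mpLift_postcomp_mpTgt _ _ _ _ _ _ _ _ d f (by simp) (by simp) (by simp)

/-- If `k = g * f`, then `f` lifts to the mapping path of `g` in such a way that the composition
with the projection to the target is `k`. -/
lemma exists_lift_of_isConcat (d : BinaryDegree I) {E : Diagram C} (g : S.HoMor B E)
    (k : S.HoMor A E) (h : IsConcat f g k) :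
    ∃ l : S.HoMor A (mappingPath g), l.postcomp g.mpFst = f ∧ l.postcomp (g.mpTgt d) = k := by
  obtain ⟨h₁, h₂⟩ := h
  choose L hL₀ hL₁ hL using h₂
  replace hL₀ {i j : I} (a : i ⟶ j) (ha : NonIdentity a) : L a ha ≫ (S.pcat j).src _ =
    f.htpy a ha ≫ (S.pcat j).P.map (g.app j) := hL₀ a ha
  replace hL₁ {i j : I} (a : i ⟶ j) (ha : NonIdentity a) : L a ha ≫ (S.pcat j).P.map
    ((S.pcat j).tgt (E.obj j)) = (push C a).map (f.app i) ≫ g.htpy a ha := hL₁ a ha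
  replace hL {i j : I} (a : i ⟶ j) (ha : NonIdentity a) :
    k.htpy a ha = L a ha ≫ (S.pcat j).fld (E.obj j) := hL a ha
  -- The paths can be constant because k_i = g_i f_i. The turned square of L fills the triangle on
  -- P(g_j) F_a, G_a f_i and their folding ∇ L_a.
  refine ⟨g.mpLift f (fun i => k.app i ≫ (S.pcat i).inc (E.obj i))
    (fun i j a ha => L a ha ≫ (S.pcat j).turn (E.obj j)) ?_ ?_ ?_ ?_,
    mpLift_postcomp_mpFst .., mpLift_postcomp_mpTgt _ _ _ _ _ _ _ _ d k ?_ ?_ ?_⟩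
  · intro i
    rw [Category.assoc, FunctorialPath.inc_src, Category.comp_id, h₁]
  · intro i j a ha
    rw [Category.assoc, StructuredPath.turn_map_src, hL₀]
  · intro i j a ha
    rw [Category.assoc, StructuredPath.turn_src, ← Category.assoc, hL₀, Category.assoc,
      FunctorialPath.map_src_assoc, htpy_src_assoc, h₁, Category.assoc]
  · intro i j a ha
    rw [Category.assoc, StructuredPath.turn_tgt, hL₁]
  · intro i; exact (h₁ i).symm
  · intro i
    rw [Category.assoc, FunctorialPath.inc_tgt, Category.comp_id]
  · intro i j a ha
    rw [Category.assoc, StructuredPath.turn_map_tgt, hL]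

/-- P(g_j) F_a ends where G_a f_i starts, and cofibrancy of a_*(A_i) provides a square with these
two sides; folding it gives the homotopy. -/
lemma exists_isConcat (hA : S.cof A) {E : Diagram C} (g : S.HoMor B E) :
    ∃ k : S.HoMor A E, IsConcat f g k := by
  have h {i j : I} (a : i ⟶ j) (ha : NonIdentity a) := (hA.2 a).exists_square
    (f.htpy a ha ≫ (S.pcat j).P.map (g.app j)) ((push C a).map (f.app i) ≫ g.htpy a ha) (by
      rw [Category.assoc, Category.assoc, FunctorialPath.map_tgt, htpy_src, htpy_tgt_assoc])
  choose L hL₀ hL₁ using @h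
  refine ⟨{ app i := f.app i ≫ g.app i
            htpy {_ j} a ha := L a ha ≫ (S.pcat j).fld (E.obj j)
            htpy_δ₀ := ?_, htpy_δ₁ := ?_ }, fun i => rfl,
    fun i j a ha => ⟨L a ha, hL₀ a ha, hL₁ a ha, rfl⟩⟩
  · intro i j a ha
    change _ ≫ (S.pcat j).src (E.obj j) = _
    rw [Category.assoc, StructuredPath.fld_src, ← Category.assoc, hL₀, Category.assoc,
      FunctorialPath.map_src, htpy_src_assoc]
  · intro i j a ha
    change _ ≫ (S.pcat j).tgt (E.obj j) = _
    rw [Category.assoc, StructuredPath.fld_tgt, ← FunctorialPath.map_tgt, ← Category.assoc, hL₁,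
      Category.assoc, htpy_tgt, Functor.map_comp_assoc]

/-- The mapping path of a morphism has a section which is a morphism. -/
lemma exists_mpSection_ofHom (d : BinaryDegree I) (f : A ⟶ B) :
    ∃ s : A ⟶ mappingPath (ofHom S f), s ≫ (ofHom S f).mpFst = 𝟙 A ∧
      s ≫ (ofHom S f).mpTgt d = f := by
  let s (i : I) : A.obj i ⟶ (mappingPath (ofHom S f)).obj i :=
    ((ofHom S f).isPullback_mp i).lift (𝟙 _) (f.app i ≫ (S.pcat i).inc (B.obj i)) (by simp)
  have hs (i : I) : s i ≫ (ofHom S f).mpFst.app i = 𝟙 _ :=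
    ((ofHom S f).isPullback_mp i).lift_fst _ _ _
  have hs' (i : I) : s i ≫ (ofHom S f).mpPath i = f.app i ≫ (S.pcat i).inc (B.obj i) :=
    ((ofHom S f).isPullback_mp i).lift_snd _ _ _
  refine ⟨{ app := s, comm := ?_ }, Diagram.hom_ext hs, Diagram.hom_ext fun i => ?_⟩
  -- The homotopy inserted by the mapping path is the constant one, so here the constant paths
  -- commute strictly with the comparison morphisms.
  · intro i j a ha
    apply ((ofHom S f).isPullback_mp j).hom_ext
    · rw [Category.assoc, Category.assoc, hs, φ_mpFst, ← Functor.map_comp_assoc, hs,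
        CategoryTheory.Functor.map_id, Category.id_comp, Category.comp_id]
    · rw [Category.assoc, Category.assoc, hs', φ_mpPath, ← Functor.map_comp_assoc, hs,
        CategoryTheory.Functor.map_id, Category.id_comp, ofHom_htpy]
  · change s i ≫ _ = _
    by_cases hi : d.deg i = 0
    · rw [mpTgt_app_of_eq hi, ← Category.assoc, hs, Category.id_comp, ofHom_app]
    · rw [mpTgt_app_of_ne hi, ← Category.assoc, hs', Category.assoc, FunctorialPath.inc_tgt,
        Category.comp_id]

end HoMor

end MappingPath

end PDiagram

/-! ### Homotopies and mapping paths -/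

namespace PDiagram

section MappingPathHomotopy

variable {I : Type w} [Category.{w} I] {C : I ⥤ Cat.{v, u}} [∀ i, HasFiniteProducts (C.obj i)]
  {S : PDiagram C}

namespace HoMor

variable {A B : Diagram C} (f : S.HoMor A B)

lemma isPullback_map_map_mp (i : I) :
    IsPullback ((S.pcat i).P.map ((S.pcat i).P.map (f.mpFst.app i)))
      ((S.pcat i).P.map ((S.pcat i).P.map (f.mpPath i)))
      ((S.pcat i).P.map ((S.pcat i).P.map (f.app i)))
      ((S.pcat i).P.map ((S.pcat i).P.map ((S.pcat i).src (B.obj i)))) :=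
  (S.pcat i).isPullback_map (f.isPullback_map_mp i)
    ((S.pcat i).fib_map _ ((S.pcat i).fib_δ₀ _))

lemma mpSection_app_mpFst (i : I) : f.mpSection.app i ≫ f.mpFst.app i = 𝟙 _ :=
  mpLift_app_mpFst ..

lemma mpSection_app_mpPath (i : I) :
    f.mpSection.app i ≫ f.mpPath i = f.app i ≫ (S.pcat i).inc (B.obj i) :=
  mpLift_app_mpPath ..

lemma mpSection_htpy_mpFst {i j : I} (a : i ⟶ j) (ha : NonIdentity a) :
    f.mpSection.htpy a ha ≫ (S.pcat j).P.map (f.mpFst.app j) =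
      A.φ a ha ≫ (S.pcat j).inc (A.obj j) :=
  (mpLift_htpy_mpFst ..).trans (by rw [ofHom_htpy, Diagram.id_app, Category.id_comp])

lemma mpSection_htpy_mpPath {i j : I} (a : i ⟶ j) (ha : NonIdentity a) :
    f.mpSection.htpy a ha ≫ (S.pcat j).P.map (f.mpPath j) =
      f.htpy a ha ≫ (S.pcat j).conn (B.obj j) :=
  mpLift_htpy_mpPath ..

/-- The contraction of the mapping path of `f : A ⇝ B` to `A`, at some level. -/
noncomputable def mpContraction (i : I) :
    (mappingPath f).obj i ⟶ (S.pcat i).P.obj ((mappingPath f).obj i) :=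
  (f.isPullback_map_mp i).lift (f.mpFst.app i ≫ (S.pcat i).inc (A.obj i))
    (f.mpPath i ≫ (S.pcat i).conn (B.obj i)) (by
      rw [Category.assoc, Category.assoc, FunctorialPath.inc_map, StructuredPath.conn_map_src,
        (f.isPullback_mp i).w_assoc])

lemma mpContraction_mpFst (i : I) :
    f.mpContraction i ≫ (S.pcat i).P.map (f.mpFst.app i) =
      f.mpFst.app i ≫ (S.pcat i).inc (A.obj i) :=
  (f.isPullback_map_mp i).lift_fst _ _ _

lemma mpContraction_mpPath (i : I) :
    f.mpContraction i ≫ (S.pcat i).P.map (f.mpPath i) =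
      f.mpPath i ≫ (S.pcat i).conn (B.obj i) :=
  (f.isPullback_map_mp i).lift_snd _ _ _

lemma mpContraction_src (i : I) :
    f.mpContraction i ≫ (S.pcat i).src ((mappingPath f).obj i) =
      f.mpFst.app i ≫ f.mpSection.app i := by
  apply (f.isPullback_mp i).hom_ext
  · rw [Category.assoc, Category.assoc, mpSection_app_mpFst, ← FunctorialPath.map_src,
      ← Category.assoc, mpContraction_mpFst, Category.assoc, FunctorialPath.inc_src]
  · rw [Category.assoc, Category.assoc, mpSection_app_mpPath, ← FunctorialPath.map_src,
      ← Category.assoc, mpContraction_mpPath, Category.assoc, StructuredPath.conn_src,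
      (f.isPullback_mp i).w_assoc]

lemma mpContraction_tgt (i : I) :
    f.mpContraction i ≫ (S.pcat i).tgt ((mappingPath f).obj i) = 𝟙 _ := by
  apply (f.isPullback_mp i).hom_ext
  · rw [Category.assoc, ← FunctorialPath.map_tgt, ← Category.assoc, mpContraction_mpFst,
      Category.assoc, FunctorialPath.inc_tgt, Category.id_comp, Category.comp_id]
  · rw [Category.assoc, ← FunctorialPath.map_tgt, ← Category.assoc, mpContraction_mpPath,
      Category.assoc, StructuredPath.conn_tgt, Category.id_comp, Category.comp_id]

/-- The homotopies which, together with the contractions, make up a ho-morphism. -/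
noncomputable def mpContractionHtpy {i j : I} (a : i ⟶ j) (ha : NonIdentity a) :
    (push C a).obj ((mappingPath f).obj i) ⟶
      (S.pcat j).P.obj ((S.pcat j).P.obj ((mappingPath f).obj j)) :=
  (f.isPullback_map_map_mp j).lift
    ((push C a).map (f.mpFst.app i) ≫ A.φ a ha ≫ (S.pcat j).inc (A.obj j) ≫ (S.pcat j).inc _)
    -- Heuristically this is the cube F((s ∨ t) ∧ u). For s = 0 or t = 0 it is the contraction c F
    -- of the inserted path; for s = 1 or t = 1 it is constant at F, as the contraction of the path
    -- at level i is forgotten.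
    ((push C a).map (f.mpFst.app i) ≫ f.htpy a ha ≫ (S.pcat j).conn (B.obj j) ≫
      (S.pcat j).coconn _) (by
      simp only [Category.assoc]
      rw [FunctorialPath.inc_map, FunctorialPath.inc_map_assoc, ← StructuredPath.map_coconn,
        StructuredPath.conn_map_src_assoc, htpy_src_assoc, StructuredPath.inc_coconn])

lemma mpContractionHtpy_mpFst {i j : I} (a : i ⟶ j) (ha : NonIdentity a) :
    f.mpContractionHtpy a ha ≫ (S.pcat j).P.map ((S.pcat j).P.map (f.mpFst.app j)) =
      (push C a).map (f.mpFst.app i) ≫ A.φ a ha ≫ (S.pcat j).inc (A.obj j) ≫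
        (S.pcat j).inc _ :=
  (f.isPullback_map_map_mp j).lift_fst _ _ _

lemma mpContractionHtpy_mpPath {i j : I} (a : i ⟶ j) (ha : NonIdentity a) :
    f.mpContractionHtpy a ha ≫ (S.pcat j).P.map ((S.pcat j).P.map (f.mpPath j)) =
      (push C a).map (f.mpFst.app i) ≫ f.htpy a ha ≫ (S.pcat j).conn (B.obj j) ≫
        (S.pcat j).coconn _ :=
  (f.isPullback_map_map_mp j).lift_snd _ _ _

lemma mpContractionHtpy_src {i j : I} (a : i ⟶ j) (ha : NonIdentity a) :
    f.mpContractionHtpy a ha ≫ (S.pcat j).src ((S.pcat j).P.obj ((mappingPath f).obj j)) =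
      (mappingPath f).φ a ha ≫ f.mpContraction j := by
  apply (f.isPullback_map_mp j).hom_ext
  · rw [Category.assoc, Category.assoc, mpContraction_mpFst, ← FunctorialPath.map_src,
      ← Category.assoc, mpContractionHtpy_mpFst, φ_mpFst_assoc]
    simp
  · rw [Category.assoc, Category.assoc, mpContraction_mpPath, ← FunctorialPath.map_src,
      ← Category.assoc, mpContractionHtpy_mpPath, φ_mpPath_assoc]
    simp

lemma mpContractionHtpy_tgt {i j : I} (a : i ⟶ j) (ha : NonIdentity a) :
    f.mpContractionHtpy a ha ≫ (S.pcat j).tgt ((S.pcat j).P.obj ((mappingPath f).obj j)) =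
      (push C a).map (f.mpContraction i) ≫ S.swap a ((mappingPath f).obj i) ≫
        (S.pcat j).P.map ((mappingPath f).φ a ha) := by
  have h : (push C a).map (f.mpContraction i) ≫ S.swap a ((mappingPath f).obj i) ≫
      (S.pcat j).P.map ((push C a).map (f.mpFst.app i)) =
      (push C a).map (f.mpFst.app i) ≫ (S.pcat j).inc ((push C a).obj (A.obj i)) := by
    rw [← map_map_swap, ← Functor.map_comp_assoc, mpContraction_mpFst, Functor.map_comp_assoc,
      map_inc_swap]
  apply (f.isPullback_map_mp j).hom_ext
  · rw [Category.assoc, Category.assoc, Category.assoc, ← FunctorialPath.map_tgt,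
      ← Category.assoc, mpContractionHtpy_mpFst, ← Functor.map_comp, φ_mpFst, Functor.map_comp,
      reassoc_of% h, FunctorialPath.inc_map]
    simp
  · rw [Category.assoc, Category.assoc, Category.assoc, ← FunctorialPath.map_tgt,
      ← Category.assoc, mpContractionHtpy_mpPath, ← Functor.map_comp, φ_mpPath, Functor.map_comp,
      reassoc_of% h, FunctorialPath.inc_map]
    simp

/-- Every path is contracted to its starting point. The connecting homotopies are cubes whose four
faces are dictated by the contraction at levels i and j, by the section, and by the identity. -/
lemma homotopic_mpSection_precomp :
    Homotopic (f.mpSection.precomp f.mpFst) (ofHom S (𝟙 (mappingPath f))) := by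
  refine ⟨{ app := f.mpContraction
            htpy {_ _} a ha := f.mpContractionHtpy a ha
            htpy_δ₀ := f.mpContractionHtpy_src
            htpy_δ₁ := f.mpContractionHtpy_tgt },
    hext f.mpContraction_src fun i j a ha => ?_, hext f.mpContraction_tgt fun i j a ha => ?_⟩
  · change f.mpContractionHtpy a ha ≫ (S.pcat j).P.map ((S.pcat j).src ((mappingPath f).obj j)) =
      (push C a).map (f.mpFst.app i) ≫ f.mpSection.htpy a ha
    apply (f.isPullback_map_mp j).hom_ext
    · rw [Category.assoc, Category.assoc, mpSection_htpy_mpFst, ← (S.pcat j).P.map_comp,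
        ← FunctorialPath.map_src, (S.pcat j).P.map_comp, ← Category.assoc,
        mpContractionHtpy_mpFst]
      simp [FunctorialPath.inc_map]
    · rw [Category.assoc, Category.assoc, mpSection_htpy_mpPath, ← (S.pcat j).P.map_comp,
        ← FunctorialPath.map_src, (S.pcat j).P.map_comp, ← Category.assoc,
        mpContractionHtpy_mpPath]
      simp
  · change f.mpContractionHtpy a ha ≫ (S.pcat j).P.map ((S.pcat j).tgt ((mappingPath f).obj j)) = _
    rw [ofHom_htpy, Diagram.id_app, Category.id_comp]
    apply (f.isPullback_map_mp j).hom_ext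
    · rw [Category.assoc, Category.assoc, FunctorialPath.inc_map, φ_mpFst_assoc,
        ← (S.pcat j).P.map_comp, ← FunctorialPath.map_tgt, (S.pcat j).P.map_comp,
        ← Category.assoc, mpContractionHtpy_mpFst]
      simp [FunctorialPath.inc_map]
    · rw [Category.assoc, Category.assoc, FunctorialPath.inc_map, φ_mpPath_assoc,
        ← (S.pcat j).P.map_comp, ← FunctorialPath.map_tgt, (S.pcat j).P.map_comp,
        ← Category.assoc, mpContractionHtpy_mpPath]
      simp

/-- The projection of the mapping path of `f : A ⇝ B` to `A` is a ho-equivalence. -/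
lemma hoEquiv_mpFst : S.hoEquiv f.mpFst :=
  ⟨f.mpSection, toClass_eq f.homotopic_mpSection_precomp, by rw [mpSection_postcomp_mpFst]⟩

/-- The ho-morphism from the mapping path of `f : A ⇝ B` to `B` given by the targets of paths. -/
noncomputable def mpEnd : S.HoMor (mappingPath f) B where
  app i := f.mpPath i ≫ (S.pcat i).tgt (B.obj i)
  -- At level j the end of the inserted F_a is φ_a f_i, the image of the start of the path at level
  -- i. That path, pushed forward, joins it to the image of its own end.
  htpy {i j} a ha := (push C a).map (f.mpPath i) ≫ S.swap a (B.obj i) ≫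
    (S.pcat j).P.map (B.φ a ha)
  htpy_δ₀ {i j} a ha := by
    change _ ≫ (S.pcat j).src (B.obj j) = _
    rw [φ_mpPath_assoc, htpy_tgt, Category.assoc, Category.assoc, FunctorialPath.map_src,
      swap_src_assoc, ← Functor.map_comp_assoc, ← Functor.map_comp_assoc,
      (f.isPullback_mp i).w]
  htpy_δ₁ {i j} a ha := by
    change _ ≫ (S.pcat j).tgt (B.obj j) = _
    rw [Category.assoc, Category.assoc, FunctorialPath.map_tgt,
      swap_tgt_assoc, ← Functor.map_comp_assoc]

lemma mpEnd_app (i : I) : f.mpEnd.app i = f.mpPath i ≫ (S.pcat i).tgt (B.obj i) := rfl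

lemma mpEnd_htpy {i j : I} (a : i ⟶ j) (ha : NonIdentity a) :
    f.mpEnd.htpy a ha = (push C a).map (f.mpPath i) ≫ S.swap a (B.obj i) ≫
      (S.pcat j).P.map (B.φ a ha) := rfl

/-- The path object of `B` maps to an iterated mapping path, compatibly with the end points. -/
lemma exists_path_to_mappingPath (d : BinaryDegree I) (B : Diagram C) :
    ∃ r : S.path B ⟶ mappingPath (ofHom S (𝟙 B)).mpEnd,
      r ≫ (ofHom S (𝟙 B)).mpEnd.mpFst ≫ (ofHom S (𝟙 B)).mpFst = S.pathδ₀ B ∧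
      r ≫ (ofHom S (𝟙 B)).mpEnd.mpTgt d = S.pathδ₁ B := by
  set f := ofHom S (𝟙 B) with hf
  -- A point of the iterated mapping path is a pair of consecutive paths. A path γ goes to (γ,
  -- constant) in degree 0 and to (constant, γ) in degree 1: the outer comparison morphism inserts
  -- the homotopy of `mpEnd`, which is the first path pushed forward, as the second path. A single
  -- mapping path would forget γ.
  let r₁ (i : I) : (S.pcat i).P.obj (B.obj i) ⟶ (mappingPath f).obj i :=
    (f.isPullback_mp i).lift ((S.pcat i).src (B.obj i))
      (if d.deg i = 0 then 𝟙 _ else (S.pcat i).src (B.obj i) ≫ (S.pcat i).inc (B.obj i)) (by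
        split_ifs <;> simp [hf])
  have hr₁ (i : I) : r₁ i ≫ f.mpFst.app i = (S.pcat i).src (B.obj i) :=
    (f.isPullback_mp i).lift_fst _ _ _
  have hr₁' (i : I) : r₁ i ≫ f.mpPath i = if d.deg i = 0 then 𝟙 _ else
      (S.pcat i).src (B.obj i) ≫ (S.pcat i).inc (B.obj i) :=
    (f.isPullback_mp i).lift_snd _ _ _
  let r (i : I) : (S.pcat i).P.obj (B.obj i) ⟶ (mappingPath f.mpEnd).obj i :=
    (f.mpEnd.isPullback_mp i).lift (r₁ i)
      (if d.deg i = 0 then (S.pcat i).tgt (B.obj i) ≫ (S.pcat i).inc (B.obj i) else 𝟙 _) (by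
        rw [mpEnd_app, ← Category.assoc, hr₁']
        split_ifs <;> simp)
  have hr (i : I) : r i ≫ f.mpEnd.mpFst.app i = r₁ i := (f.mpEnd.isPullback_mp i).lift_fst _ _ _
  have hr' (i : I) : r i ≫ f.mpEnd.mpPath i = if d.deg i = 0 then
      (S.pcat i).tgt (B.obj i) ≫ (S.pcat i).inc (B.obj i) else 𝟙 _ :=
    (f.mpEnd.isPullback_mp i).lift_snd _ _ _
  refine ⟨{ app := r, comm := ?_ }, Diagram.hom_ext fun i => ?_, Diagram.hom_ext fun i => ?_⟩
  · intro i j a ha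
    obtain ⟨hi, hj⟩ := d.source_target a ha
    change (S.swap a (B.obj i) ≫ (S.pcat j).P.map (B.φ a ha)) ≫ r j =
      (push C a).map (r i) ≫ (mappingPath f.mpEnd).φ a ha
    apply (f.mpEnd.isPullback_mp j).hom_ext
    · apply (f.isPullback_mp j).hom_ext
      · simp only [Category.assoc, φ_mpFst]
        rw [reassoc_of% (hr j), hr₁, FunctorialPath.map_src, swap_src_assoc,
          ← (push C a).map_comp_assoc (r i), hr, ← (push C a).map_comp_assoc (r₁ i), hr₁]
      · simp only [Category.assoc, φ_mpFst_assoc, φ_mpPath]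
        rw [reassoc_of% (hr j), hr₁', if_neg hj, FunctorialPath.map_src_assoc, swap_src_assoc,
          ← (push C a).map_comp_assoc (r i), hr, ← (push C a).map_comp_assoc (r₁ i), hr₁,
          hf, ofHom_htpy, Diagram.id_app, Category.id_comp]
    · simp only [Category.assoc, φ_mpPath]
      rw [hr', if_neg hj, Category.comp_id, mpEnd_htpy, ← (push C a).map_comp_assoc (r i), hr,
        ← (push C a).map_comp_assoc (r₁ i), hr₁', if_pos hi, CategoryTheory.Functor.map_id,
        Category.id_comp]
  · change r i ≫ f.mpEnd.mpFst.app i ≫ f.mpFst.app i = (S.pcat i).src (B.obj i)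
    rw [reassoc_of% (hr i), hr₁]
  · change r i ≫ (f.mpEnd.mpTgt d).app i = (S.pcat i).tgt (B.obj i)
    by_cases hi : d.deg i = 0
    · rw [mpTgt_app_of_eq hi, reassoc_of% (hr i), mpEnd_app, reassoc_of% (hr₁' i), if_pos hi,
        Category.id_comp]
    · rw [mpTgt_app_of_ne hi, reassoc_of% (hr' i), if_neg hi, Category.id_comp]

end HoMor

end MappingPathHomotopy

end PDiagram

/-! ### Composition of homotopy classes of ho-morphisms -/

namespace PDiagram

section Composition

variable {I : Type w} [Category.{w} I] {C : I ⥤ Cat.{v, u}} [∀ i, HasFiniteProducts (C.obj i)]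
  {S : PDiagram C} (d : BinaryDegree I) {N A B E F : Diagram C}

/-- The composition of a class `x : N ⇝ A` with a ho-morphism `g : A ⇝ B`, for a level-wise
cofibrant diagram `N`: one lifts `x` to the mapping path of `g`. -/
noncomputable def HoMor.compClass (hN : S.cof N) (x : S.HoClass N A) (g : S.HoMor A B) :
    S.HoClass N B :=
  HoClass.post (g.mpTgt d)
    ((Equiv.ofBijective _ (post_bijective_of_trivFib hN g.trivFib_mpFst)).symm x)

/-- Any lift computes the composite; each property of the composition then comes from a convenient
choice of lift. -/
lemma HoMor.compClass_eq (hN : S.cof N) (g : S.HoMor A B) (l : S.HoClass N (mappingPath g)) :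
    HoMor.compClass d hN (HoClass.post g.mpFst l) g = HoClass.post (g.mpTgt d) l :=
  congrArg (HoClass.post (g.mpTgt d)) (Equiv.ofBijective_symm_apply_apply _ _ l)

lemma exists_lift_mappingPath (hN : S.cof N) (x : S.HoClass N A) (g : S.HoMor A B) :
    ∃ l : S.HoClass N (mappingPath g), HoClass.post g.mpFst l = x :=
  (post_bijective_of_trivFib hN g.trivFib_mpFst).2 x

lemma HoClass.post_δ₀_eq_post_δ₁ (x : S.HoClass N (S.path A)) :
    HoClass.post (S.pathδ₀ A) x = HoClass.post (S.pathδ₁ A) x := by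
  obtain ⟨f, rfl⟩ := toClass_surjective x
  exact toClass_eq ⟨f, rfl, rfl⟩

lemma HoMor.compClass_postcomp (hN : S.cof N) (x : S.HoClass N A) (g : S.HoMor A B) (h : B ⟶ E) :
    HoMor.compClass d hN x (g.postcomp h) = HoClass.post h (HoMor.compClass d hN x g) := by
  obtain ⟨l, rfl⟩ := exists_lift_mappingPath hN x g
  obtain ⟨r, hr, hr'⟩ := g.exists_mpMap_postcomp d h
  rw [compClass_eq, HoClass.post_post, ← hr', ← HoClass.post_post, ← compClass_eq d hN,
    HoClass.post_post, hr]

lemma HoMor.compClass_precomp (hN : S.cof N) (x : S.HoClass N A) (g : S.HoMor B E) (h : A ⟶ B) :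
    HoMor.compClass d hN x (g.precomp h) = HoMor.compClass d hN (HoClass.post h x) g := by
  obtain ⟨l, rfl⟩ := exists_lift_mappingPath hN x (g.precomp h)
  obtain ⟨r, hr, hr'⟩ := g.exists_mpMap_precomp d h
  rw [compClass_eq, HoClass.post_post, ← hr', ← hr, ← HoClass.post_post, ← HoClass.post_post,
    ← compClass_eq d hN]

/-- Both composites are images, under δ₀ and δ₁, of the composite of x with the homotopy, and δ₀ and
δ₁ agree on classes. -/
lemma HoMor.compClass_eq_of_homotopic (hN : S.cof N) (x : S.HoClass N A) {g g' : S.HoMor A B}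
    (h : Homotopic g g') : HoMor.compClass d hN x g = HoMor.compClass d hN x g' := by
  obtain ⟨h, rfl, rfl⟩ := h
  rw [compClass_postcomp, compClass_postcomp, HoClass.post_δ₀_eq_post_δ₁]

/-- The composition of classes of ho-morphisms from a level-wise cofibrant diagram. -/
noncomputable def HoClass.comp (hN : S.cof N) (x : S.HoClass N A) (y : S.HoClass A B) :
    S.HoClass N B :=
  Quot.lift (HoMor.compClass d hN x)
    (fun _ _ h => HoMor.compClass_eq_of_homotopic d hN x h) y

namespace HoClass

lemma comp_toClass (hN : S.cof N) (x : S.HoClass N A) (g : S.HoMor A B) :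
    comp d hN x g.toClass = HoMor.compClass d hN x g := rfl

lemma comp_post (hN : S.cof N) (x : S.HoClass N A) (y : S.HoClass A B) (h : B ⟶ E) :
    comp d hN x (post h y) = post h (comp d hN x y) := by
  obtain ⟨g, rfl⟩ := toClass_surjective y
  exact HoMor.compClass_postcomp d hN x g h

lemma comp_pre (hN : S.cof N) (x : S.HoClass N A) (y : S.HoClass B E) (h : A ⟶ B) :
    comp d hN x (pre h y) = comp d hN (post h x) y := by
  obtain ⟨g, rfl⟩ := toClass_surjective y
  exact HoMor.compClass_precomp d hN x g h

lemma comp_ofHom (hN : S.cof N) (x : S.HoClass N A) (g : A ⟶ B) :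
    comp d hN x (HoMor.ofHom S g).toClass = post g x := by
  obtain ⟨s, hs, hs'⟩ := HoMor.exists_mpSection_ofHom (S := S) d g
  have h := HoMor.compClass_eq d hN (HoMor.ofHom S g) (post s x)
  rw [post_post, post_post, hs, hs', post_id] at h
  exact h

lemma id_comp (hN : S.cof N) (y : S.HoClass N A) :
    comp d hN (HoMor.ofHom S (𝟙 N)).toClass y = y := by
  obtain ⟨g, rfl⟩ := toClass_surjective y
  have h := HoMor.compClass_eq d hN g g.mpSection.toClass
  rw [post_toClass, post_toClass, g.mpSection_postcomp_mpFst, g.mpSection_postcomp_mpTgt] at h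
  exact h

lemma comp_id (hN : S.cof N) (x : S.HoClass N A) :
    comp d hN x (HoMor.ofHom S (𝟙 A)).toClass = x := by
  rw [comp_ofHom, post_id]

/-- Once y is lifted to the mapping path of z, which needs A cofibrant, composing with z amounts to
composing with a morphism. -/
lemma assoc (hN : S.cof N) (hA : S.cof A) (x : S.HoClass N A) (y : S.HoClass A B)
    (z : S.HoClass B E) :
    comp d hN (comp d hN x y) z = comp d hN x (comp d hA y z) := by
  obtain ⟨g, rfl⟩ := toClass_surjective z
  obtain ⟨l, rfl⟩ := exists_lift_mappingPath hA y g
  rw [comp_toClass, comp_toClass, HoMor.compClass_eq, comp_post, comp_post, HoMor.compClass_eq]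

lemma comp_eq_of_isConcat (hN : S.cof N) (f : S.HoMor N A) (g : S.HoMor A B) (k : S.HoMor N B)
    (h : IsConcat f g k) : comp d hN f.toClass g.toClass = k.toClass := by
  obtain ⟨l, rfl, rfl⟩ := f.exists_lift_of_isConcat d g k h
  exact HoMor.compClass_eq d hN g l.toClass

end HoClass

/-- Ho-equivalences induce bijections on homotopy classes of ho-morphisms from a level-wise
cofibrant diagram. -/
lemma post_bijective_of_hoEquiv (d : BinaryDegree I) (hN : S.cof N) {f : A ⟶ B}
    (hf : S.hoEquiv f) :
    Function.Bijective (HoClass.post f : S.HoClass N A → S.HoClass N B) := by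
  obtain ⟨g, h₁, h₂⟩ := hf
  rw [← HoClass.pre_toClass] at h₁
  rw [← HoClass.post_toClass] at h₂
  refine Function.bijective_iff_has_inverse.2 ⟨fun x => HoClass.comp d hN x g.toClass, ?_, ?_⟩
  · intro x
    change HoClass.comp d hN _ _ = x
    rw [← HoClass.comp_pre, h₁, HoClass.comp_id]
  · intro x
    change HoClass.post f (HoClass.comp d hN _ _) = x
    rw [← HoClass.comp_post, h₂, HoClass.comp_id]

lemma post_bijective_of_hoEquivClosure (d : BinaryDegree I) (hN : S.cof N) {f : A ⟶ B}
    (hf : S.hoEquivClosure f) :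
    Function.Bijective (HoClass.post f : S.HoClass N A → S.HoClass N B) := by
  induction hf with
  | of f hf => exact post_bijective_of_hoEquiv d hN hf
  | id x => exact (funext HoClass.post_id : HoClass.post (𝟙 x) = id) ▸ Function.bijective_id
  | comp_of f g _ hg ih =>
    rw [← funext (HoClass.post_post f g)]
    exact (post_bijective_of_hoEquiv d hN hg).comp ih

/-- The category of homotopy classes of ho-morphisms between level-wise cofibrant diagrams. -/
noncomputable def piH {M : ObjectProperty (Diagram C)} (hM : M ≤ S.cof) : S.PiH M where
  comp {A _ _} x y := HoClass.comp d (hM _ A.property) x y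
  exists_concat {A _ _} f g := f.exists_isConcat (hM _ A.property) g
  comp_eq {A _ _} f g k h := HoClass.comp_eq_of_isConcat d (hM _ A.property) f g k h
  id_comp {A _} x := HoClass.id_comp d (hM _ A.property) x
  comp_id {A _} x := HoClass.comp_id d (hM _ A.property) x
  assoc {A B _ _} x y z := HoClass.assoc d (hM _ A.property) (hM _ B.property) x y z

end Composition

end PDiagram

/-! ### Ho-morphisms in localizations -/

namespace PDiagram

section Realization

variable {I : Type w} [Category.{w} I] {C : I ⥤ Cat.{v, u}} [∀ i, HasFiniteProducts (C.obj i)]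
  {S : PDiagram C}

/-- A full subcategory of diagrams is closed under mapping paths of ho-morphisms. -/
def ClosedUnderMappingPath (S : PDiagram C) (D : ObjectProperty (Diagram C)) : Prop :=
  ∀ A B : Diagram C, D A → D B → ∀ f : S.HoMor A B, D.isoClosure (mappingPath f)

variable {D : ObjectProperty (Diagram C)} (hD : S.ClosedUnderMappingPath D)
  {A B E : D.FullSubcategory}

/-- An object of `D` isomorphic to the mapping path of `f`. -/
noncomputable def mpObj (f : S.HoMor A.obj B.obj) : D.FullSubcategory :=
  ⟨_, (hD _ _ A.property B.property f).choose_spec.choose⟩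

/-- The isomorphism of `mpObj` with the mapping path. -/
noncomputable def mpIso (f : S.HoMor A.obj B.obj) : (mpObj hD f).obj ≅ mappingPath f :=
  (hD _ _ A.property B.property f).choose_spec.choose_spec.some.symm

/-- The projection to the source, as a morphism of `D`. -/
noncomputable def mpP (f : S.HoMor A.obj B.obj) : mpObj hD f ⟶ A :=
  ObjectProperty.homMk ((mpIso hD f).hom ≫ f.mpFst)

variable (d : BinaryDegree I)

/-- The projection to the target, as a morphism of `D`. -/
noncomputable def mpQ (f : S.HoMor A.obj B.obj) : mpObj hD f ⟶ B :=
  ObjectProperty.homMk ((mpIso hD f).hom ≫ f.mpTgt d)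

lemma weq_mpP (f : S.HoMor A.obj B.obj) : S.weqOn D (mpP hD f) := fun i =>
  have := Diagram.isIso_app (mpIso hD f) i
  PCategory.weq_comp ((S.pcat i).iso_weq ((mpIso hD f).hom.app i)) (f.trivFib_mpFst i).2

lemma weq_mpQ (f : S.HoMor A.obj B.obj) (hf : f.IsWeq) : S.weqOn D (mpQ hD d f) := fun i =>
  have := Diagram.isIso_app (mpIso hD f) i
  PCategory.weq_comp ((S.pcat i).iso_weq ((mpIso hD f).hom.app i)) (HoMor.weq_mpTgt d hf i)

lemma hoEquiv_of_iso {X Y : Diagram C} (e : X ≅ Y) : S.hoEquiv e.hom :=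
  ⟨HoMor.ofHom S e.inv, by rw [HoMor.ofHom_precomp, e.hom_inv_id],
    by rw [HoMor.ofHom_postcomp, e.inv_hom_id]⟩

lemma hoEquivOn_mpP (f : S.HoMor A.obj B.obj) : S.hoEquivOn D (mpP hD f) :=
  .comp_of _ _ (.of _ (hoEquiv_of_iso _)) f.hoEquiv_mpFst

variable {K : Type*} [Category* K] (L : D.FullSubcategory ⥤ K)
  (hL : ∀ ⦃A B : D.FullSubcategory⦄ (f : S.HoMor A.obj B.obj), IsIso (L.map (mpP hD f)))

/-- The morphism induced by a ho-morphism in a category where the projections of mapping paths to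
the source are invertible. -/
noncomputable def realize (f : S.HoMor A.obj B.obj) : L.obj A ⟶ L.obj B :=
  have := hL f
  inv (L.map (mpP hD f)) ≫ L.map (mpQ hD d f)

lemma map_comp_realize (f : S.HoMor A.obj B.obj) {Z : D.FullSubcategory}
    (r : Z.obj ⟶ mappingPath f) :
    L.map (ObjectProperty.homMk (r ≫ f.mpFst) : Z ⟶ A) ≫ realize hD d L hL f =
      L.map (ObjectProperty.homMk (r ≫ f.mpTgt d) : Z ⟶ B) := by
  have := hL f
  let r' : Z ⟶ mpObj hD f := ObjectProperty.homMk (r ≫ (mpIso hD f).inv)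
  have h₁ : (ObjectProperty.homMk (r ≫ f.mpFst) : Z ⟶ A) = r' ≫ mpP hD f := by
    ext1; simp [r', mpP]
  have h₂ : (ObjectProperty.homMk (r ≫ f.mpTgt d) : Z ⟶ B) = r' ≫ mpQ hD d f := by
    ext1; simp [r', mpQ]
  rw [h₁, h₂, L.map_comp, L.map_comp, realize, Category.assoc, IsIso.hom_inv_id_assoc]

lemma realize_eq_iff (f : S.HoMor A.obj B.obj) (g : L.obj A ⟶ L.obj B) :
    realize hD d L hL f = g ↔ L.map (mpQ hD d f) = L.map (mpP hD f) ≫ g := by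
  have := hL f
  rw [realize, IsIso.inv_comp_eq]

lemma realize_ofHom (f : A ⟶ B) : realize hD d L hL (HoMor.ofHom S f.hom) = L.map f := by
  obtain ⟨s, hs, hs'⟩ := HoMor.exists_mpSection_ofHom (S := S) d f.hom
  have h := map_comp_realize hD d L hL (HoMor.ofHom S f.hom) s
  rw [hs, hs'] at h
  exact (Category.id_comp _).symm.trans ((congrArg (· ≫ _) (L.map_id A).symm).trans h)

lemma realize_precomp (f : S.HoMor B.obj E.obj) (g : A ⟶ B) :
    realize hD d L hL (f.precomp g.hom : S.HoMor A.obj E.obj) =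
      L.map g ≫ realize hD d L hL f := by
  obtain ⟨r, hr, hr'⟩ := f.exists_mpMap_precomp d g.hom
  have h := map_comp_realize hD d L hL f ((mpIso hD (f.precomp g.hom)).hom ≫ r)
  rw [realize_eq_iff, ← Category.assoc, ← L.map_comp]
  rw [Category.assoc, hr, Category.assoc, hr', ← Category.assoc] at h
  exact h.symm

lemma realize_postcomp (f : S.HoMor A.obj B.obj) (g : B ⟶ E) :
    realize hD d L hL (f.postcomp g.hom : S.HoMor A.obj E.obj) =
      realize hD d L hL f ≫ L.map g := by
  have := hL f
  obtain ⟨r, hr, hr'⟩ := f.exists_mpMap_postcomp d g.hom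
  have h := map_comp_realize hD d L hL (f.postcomp g.hom : S.HoMor A.obj E.obj)
    ((mpIso hD f).hom ≫ r)
  rw [Category.assoc, hr, Category.assoc, hr', ← Category.assoc] at h
  rw [realize, realize, Category.assoc, IsIso.eq_inv_comp, ← L.map_comp]
  exact h

/-- R takes the place of P(B), which need not lie in 𝓓. Constant paths give u and v a common section
s; L(u) is invertible as a composite of projections, so L(s) is invertible and L(u) = L(v). -/
lemma exists_path_to_object {D : ObjectProperty (Diagram C)} (hD : S.ClosedUnderMappingPath D)
    (d : BinaryDegree I) {K : Type*} [Category* K] (L : D.FullSubcategory ⥤ K)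
    (hL : ∀ ⦃A B : D.FullSubcategory⦄ (f : S.HoMor A.obj B.obj), IsIso (L.map (mpP hD f)))
    (B : D.FullSubcategory) :
    ∃ (R : D.FullSubcategory) (r : S.path B.obj ⟶ R.obj) (u v : R ⟶ B),
      r ≫ u.hom = S.pathδ₀ B.obj ∧ r ≫ v.hom = S.pathδ₁ B.obj ∧ L.map u = L.map v := by
  have h := HoMor.exists_path_to_mappingPath (S := S) d B.obj
  generalize HoMor.ofHom S (𝟙 B.obj) = f at h
  obtain ⟨r, hr, hr'⟩ := h
  let e := mpIso hD f
  -- The source of `mpEnd` is only isomorphic to an object of 𝓓, so the second mapping path is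
  -- formed after transport along e.
  let q : S.HoMor (mpObj hD f).obj B.obj := f.mpEnd.precomp e.hom
  obtain ⟨t, ht, ht'⟩ := q.exists_mpMap d f.mpEnd e.inv (𝟙 _) (by
    rw [HoMor.postcomp_id, HoMor.precomp_precomp, e.inv_hom_id, HoMor.precomp_id])
  let e' := mpIso hD q
  have h₀ : (r ≫ t ≫ e'.inv) ≫ (mpP hD q ≫ mpP hD f).hom = S.pathδ₀ B.obj := by
    simp only [mpP, ObjectProperty.FullSubcategory.comp_hom, ObjectProperty.homMk_hom,
      Category.assoc]
    rw [← hr, Iso.inv_hom_id_assoc e', reassoc_of% ht, Iso.inv_hom_id_assoc]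
  have h₁ : (r ≫ t ≫ e'.inv) ≫ (mpQ hD d q).hom = S.pathδ₁ B.obj := by
    simp only [mpQ, ObjectProperty.homMk_hom, Category.assoc]
    rw [← hr', Iso.inv_hom_id_assoc e', ht', Category.comp_id]
  refine ⟨mpObj hD q, r ≫ t ≫ e'.inv, mpP hD q ≫ mpP hD f, mpQ hD d q, h₀, h₁, ?_⟩
  have := hL f
  have := hL q
  let s : B ⟶ mpObj hD q := ObjectProperty.homMk (S.pathι B.obj ≫ r ≫ t ≫ e'.inv)
  have hs₀ : s ≫ mpP hD q ≫ mpP hD f = 𝟙 B := by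
    ext1
    refine (Category.assoc (S.pathι B.obj) (r ≫ t ≫ e'.inv) _).trans ?_
    rw [h₀, pathι_δ₀]
    rfl
  have hs₁ : s ≫ mpQ hD d q = 𝟙 B := by
    ext1
    refine (Category.assoc (S.pathι B.obj) (r ≫ t ≫ e'.inv) _).trans ?_
    rw [h₁, pathι_δ₁]
    rfl
  have hi : IsIso (L.map (mpP hD q ≫ mpP hD f)) := by rw [L.map_comp]; infer_instance
  have hs : L.map s ≫ L.map (mpP hD q ≫ mpP hD f) = 𝟙 _ := by
    rw [← L.map_comp, hs₀, L.map_id]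
  have : IsIso (L.map s ≫ L.map (mpP hD q ≫ mpP hD f)) := by rw [hs]; infer_instance
  have : IsIso (L.map s) := IsIso.of_isIso_comp_right _ (L.map (mpP hD q ≫ mpP hD f))
  rw [← cancel_epi (L.map s), hs, ← L.map_comp, hs₁, L.map_id]

lemma realize_eq_of_homotopic {f g : S.HoMor A.obj B.obj} (h : Homotopic f g) :
    realize hD d L hL f = realize hD d L hL g := by
  obtain ⟨h, rfl, rfl⟩ := h
  obtain ⟨R, r, u, v, hu, hv, huv⟩ := exists_path_to_object hD d L hL B
  rw [← hu, ← hv, ← HoMor.postcomp_postcomp, ← HoMor.postcomp_postcomp]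
  exact (realize_postcomp hD d L hL (h.postcomp r : S.HoMor A.obj R.obj) u).trans
    (huv ▸ (realize_postcomp hD d L hL (h.postcomp r : S.HoMor A.obj R.obj) v).symm)

/-- The morphism induced by a class of ho-morphisms. -/
noncomputable def realizeClass : S.HoClass A.obj B.obj → (L.obj A ⟶ L.obj B) :=
  Quot.lift (realize hD d L hL) fun _ _ h => realize_eq_of_homotopic hD d L hL h

lemma realizeClass_toClass (f : S.HoMor A.obj B.obj) :
    realizeClass hD d L hL f.toClass = realize hD d L hL f := rfl

lemma realizeClass_ofHom (f : A ⟶ B) :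
    realizeClass hD d L hL (HoMor.ofHom S f.hom).toClass = L.map f :=
  realize_ofHom hD d L hL f

lemma realizeClass_id : realizeClass hD d L hL (HoMor.ofHom S (𝟙 A.obj)).toClass = 𝟙 _ :=
  (realizeClass_ofHom hD d L hL (𝟙 A)).trans (L.map_id A)

lemma realizeClass_post (x : S.HoClass A.obj B.obj) (g : B ⟶ E) :
    realizeClass hD d L hL (HoClass.post g.hom x : S.HoClass A.obj E.obj) =
      realizeClass hD d L hL x ≫ L.map g := by
  obtain ⟨f, rfl⟩ := toClass_surjective x
  exact realize_postcomp hD d L hL f g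

lemma realizeClass_pre (x : S.HoClass B.obj E.obj) (g : A ⟶ B) :
    realizeClass hD d L hL (HoClass.pre g.hom x : S.HoClass A.obj E.obj) =
      L.map g ≫ realizeClass hD d L hL x := by
  obtain ⟨f, rfl⟩ := toClass_surjective x
  exact realize_precomp hD d L hL f g

/-- The lift of a class of ho-morphisms to an object of `D` isomorphic to the mapping path. -/
lemma exists_lift_mpObj (hA : S.cof A.obj) (x : S.HoClass A.obj B.obj)
    (g : S.HoMor B.obj E.obj) :
    ∃ l : S.HoClass A.obj (mpObj hD g).obj, HoClass.post (mpP hD g).hom l = x ∧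
      HoClass.post (mpQ hD d g).hom l = HoMor.compClass d hA x g := by
  obtain ⟨l, rfl⟩ := exists_lift_mappingPath hA x g
  refine ⟨HoClass.post (mpIso hD g).inv l, ?_, ?_⟩
  · rw [HoClass.post_post, mpP, ObjectProperty.homMk_hom, Iso.inv_hom_id_assoc]
  · rw [HoClass.post_post, mpQ, ObjectProperty.homMk_hom, Iso.inv_hom_id_assoc,
      HoMor.compClass_eq]

lemma realizeClass_comp (hA : S.cof A.obj) (x : S.HoClass A.obj B.obj)
    (y : S.HoClass B.obj E.obj) :
    realizeClass hD d L hL (HoClass.comp d hA x y : S.HoClass A.obj E.obj) =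
      realizeClass hD d L hL x ≫ realizeClass hD d L hL y := by
  have := hL
  obtain ⟨g, rfl⟩ := toClass_surjective y
  obtain ⟨l, rfl, hl⟩ := exists_lift_mpObj hD d hA x g
  rw [HoClass.comp_toClass, ← hl, realizeClass_post, realizeClass_post, realizeClass_toClass,
    Category.assoc, realize, IsIso.hom_inv_id_assoc]

end Realization

end PDiagram

/-! ### Morphisms in localizations as homotopy classes of ho-morphisms -/

namespace PDiagram

section Representability

variable {I : Type w} [Category.{w} I] {C : I ⥤ Cat.{v, u}} [∀ i, HasFiniteProducts (C.obj i)]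
  {S : PDiagram C} {D : ObjectProperty (Diagram C)}

/-- The functor `[N, -]^h`, with values in a large enough universe. -/
def hoClassFunctor (S : PDiagram C) (D : ObjectProperty (Diagram C)) (N : Diagram C) :
    D.FullSubcategory ⥤ Type (max w u v) where
  obj X := ULift.{max w u v} (S.HoClass N X.obj)
  map f := TypeCat.ofHom fun x => ⟨HoClass.post f.hom x.down⟩
  map_id X := by
    ext x
    exact HoClass.post_id x.down
  map_comp f g := by
    ext x
    exact (HoClass.post_post f.hom g.hom x.down).symm

variable (hD : S.ClosedUnderMappingPath D) (d : BinaryDegree I)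
  {T : MorphismProperty D.FullSubcategory}
  (hT : ∀ ⦃A B : D.FullSubcategory⦄ (f : S.HoMor A.obj B.obj), IsIso (T.Q.map (mpP hD f)))
  {N : D.FullSubcategory}

lemma isInvertedBy_hoClassFunctor (hTN : ∀ ⦃A B : D.FullSubcategory⦄ (f : A ⟶ B), T f →
    Function.Bijective (HoClass.post f.hom : S.HoClass N.obj A.obj → S.HoClass N.obj B.obj)) :
    T.IsInvertedBy (S.hoClassFunctor D N.obj) := fun A B f hf => by
  rw [isIso_iff_bijective]
  exact (Equiv.ulift.symm.bijective.comp (hTN f hf)).comp Equiv.ulift.bijective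

/-- A Yoneda argument: [N, -]^h extends to a functor F on the localization, and realization extends
to a natural transformation σ from F to the functor represented by N. The inverse evaluates F at the
class of the identity of N. -/
lemma realizeClass_bijective (hN : S.cof N.obj)
    (hTN : ∀ ⦃A B : D.FullSubcategory⦄ (f : A ⟶ B), T f →
      Function.Bijective (HoClass.post f.hom : S.HoClass N.obj A.obj → S.HoClass N.obj B.obj))
    (B : D.FullSubcategory) :
    Function.Bijective (realizeClass hD d T.Q hT : S.HoClass N.obj B.obj → _) := by
  let G := S.hoClassFunctor D N.obj
  let F := Localization.Construction.lift G (isInvertedBy_hoClassFunctor hTN)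
  have hF {X Y : D.FullSubcategory} (f : X ⟶ Y) : F.map (T.Q.map f) = G.map f := 
    (Functor.congr_hom (Localization.Construction.fac G (isInvertedBy_hoClassFunctor hTN))
      f).trans ((Category.id_comp _).trans (Category.comp_id _))
  let H : T.Localization ⥤ Type (max w u v) := coyoneda.obj (.op (T.Q.obj N))
  let τ : T.Q ⋙ F ⟶ T.Q ⋙ H :=
    { app X := TypeCat.ofHom fun x : G.obj X => realizeClass hD d T.Q hT x.down
      naturality X Y f := by
        ext x
        exact (congrArg (fun k => realizeClass hD d T.Q hT
          ((ConcreteCategory.hom k : G.obj X → G.obj Y) x).down) (hF f)).trans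
            (realizeClass_post hD d T.Q hT x.down f) }
  let σ : F ⟶ H := Localization.Construction.natTransExtension τ
  have hσ (X : D.FullSubcategory) (x : S.HoClass N.obj X.obj) :
      (σ.app (T.Q.obj X) (ULift.up x : G.obj X) : T.Q.obj N ⟶ T.Q.obj X) =
        realizeClass hD d T.Q hT x := by
    have h : σ.app (T.Q.obj X) = τ.app X := Localization.Construction.NatTransExtension.app_eq τ X
    rw [h]
    rfl
  let x₀ : S.HoClass N.obj N.obj := (HoMor.ofHom S (𝟙 N.obj)).toClass
  have hx₀ : realizeClass hD d T.Q hT x₀ = 𝟙 (T.Q.obj N) := realizeClass_id hD d T.Q hT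
  let θ (α : T.Q.obj N ⟶ T.Q.obj B) : S.HoClass N.obj B.obj :=
    (F.map α (ULift.up x₀ : G.obj N) : G.obj B).down
  refine Function.bijective_iff_has_inverse.2 ⟨θ, fun x => ?_, fun α => ?_⟩
  · obtain ⟨g, rfl⟩ := toClass_surjective x
    have := hT g
    -- F(L(p)⁻¹) sends the class of the identity to its lift l, and F(L(q)) then sends l to the
    -- composite of the identity with g, which is the class of g.
    obtain ⟨l, hl, hl'⟩ := exists_lift_mpObj hD d hN x₀ g
    have hFG {X Y : D.FullSubcategory} (f : X ⟶ Y) (y : S.HoClass N.obj X.obj) :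
        (F.map (T.Q.map f) (ULift.up y : G.obj X) : G.obj Y) =
          (ULift.up (HoClass.post f.hom y) : G.obj Y) :=
      congrArg (fun k => (ConcreteCategory.hom k : G.obj X → G.obj Y) (ULift.up y)) (hF f)
    have h₁ : (F.map (inv (T.Q.map (mpP hD g))) (ULift.up x₀ : G.obj N) : G.obj (mpObj hD g)) =
        ULift.up l := by
      rw [← hl, ← hFG]
      have h := ConcreteCategory.congr_hom
        (F.map_comp (T.Q.map (mpP hD g)) (inv (T.Q.map (mpP hD g))))
          (ULift.up l : G.obj (mpObj hD g))
      rw [IsIso.hom_inv_id, F.map_id] at h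
      exact h.symm
    have h₂ : (F.map (realize hD d T.Q hT g) (ULift.up x₀ : G.obj N) : G.obj B) =
        F.map (T.Q.map (mpQ hD d g)) (F.map (inv (T.Q.map (mpP hD g))) (ULift.up x₀ : G.obj N) :
          G.obj (mpObj hD g)) :=
      ConcreteCategory.congr_hom
        (F.map_comp (inv (T.Q.map (mpP hD g))) (T.Q.map (mpQ hD d g))) _
    have h₃ := (h₂.trans (congrArg _ h₁)).trans (hFG (mpQ hD d g) l)
    exact (congrArg ULift.down h₃).trans (hl'.trans (HoClass.id_comp d hN g.toClass))
  -- Naturality of σ at an arbitrary α of the localization, evaluated at the class of the identity.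
  · have h := ConcreteCategory.congr_hom (σ.naturality α) (ULift.up x₀ : G.obj N)
    have h₁ : (σ.app (T.Q.obj B) (F.map α (ULift.up x₀ : G.obj N) : G.obj B) :
        T.Q.obj N ⟶ T.Q.obj B) =
        (σ.app (T.Q.obj N) (ULift.up x₀ : G.obj N) : T.Q.obj N ⟶ T.Q.obj N) ≫ α := h
    rw [hσ, hx₀, Category.id_comp] at h₁
    exact (hσ B (θ α)).symm.trans h₁

/-- Here f need not belong to T. The case T = 𝓗, f in 𝓦 is Cartan-Eilenberg cofibrancy; the case T =
𝓦, f in 𝓗 leads to `isStrongWeak`. -/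
lemma comp_map_bijective (hD : S.ClosedUnderMappingPath D) (d : BinaryDegree I)
    {T : MorphismProperty D.FullSubcategory}
    (hT : ∀ ⦃A B : D.FullSubcategory⦄ (f : S.HoMor A.obj B.obj), IsIso (T.Q.map (mpP hD f)))
    {N : D.FullSubcategory} (hN : S.cof N.obj)
    (hTN : ∀ ⦃A B : D.FullSubcategory⦄ (f : A ⟶ B), T f →
      Function.Bijective (HoClass.post f.hom : S.HoClass N.obj A.obj → S.HoClass N.obj B.obj))
    {A B : D.FullSubcategory} (f : A ⟶ B)
    (hf : Function.Bijective
      (HoClass.post f.hom : S.HoClass N.obj A.obj → S.HoClass N.obj B.obj)) :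
    Function.Bijective (fun g : T.Q.obj N ⟶ T.Q.obj A => g ≫ T.Q.map f) := by
  have h := (realizeClass_bijective hD d hT hN hTN B).comp hf
  have e : (realizeClass hD d T.Q hT : S.HoClass N.obj B.obj → _) ∘ HoClass.post f.hom =
      (fun g : T.Q.obj N ⟶ T.Q.obj A => g ≫ T.Q.map f) ∘ realizeClass hD d T.Q hT :=
    funext fun x => realizeClass_post hD d T.Q hT x f
  rw [e] at h
  exact (Function.Bijective.of_comp_iff _ (realizeClass_bijective hD d hT hN hTN A)).1 h

end Representability

end PDiagram

/-! ### The main theorem -/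

namespace PDiagram

section Main

variable {I : Type w} [Category.{w} I] {C : I ⥤ Cat.{v, u}} [∀ i, HasFiniteProducts (C.obj i)]
  {S : PDiagram C} {D M : ObjectProperty (Diagram C)}
  (hD : S.ClosedUnderMappingPath D) (d : BinaryDegree I)

lemma isIso_weqOn_mpP ⦃A B : D.FullSubcategory⦄ (f : S.HoMor A.obj B.obj) :
    IsIso ((S.weqOn D).Q.map (mpP hD f)) :=
  (S.weqOn D).Q_inverts _ (weq_mpP hD f)

lemma isIso_hoEquivOn_mpP ⦃A B : D.FullSubcategory⦄ (f : S.HoMor A.obj B.obj) :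
    IsIso ((S.hoEquivOn D).Q.map (mpP hD f)) :=
  (S.hoEquivOn D).Q_inverts _ (hoEquivOn_mpP hD f)

/-- The morphism of `Ho(D)` induced by a ho-morphism that is a weak equivalence is invertible. -/
lemma isIso_realize_of_isWeq {A B : D.FullSubcategory} (f : S.HoMor A.obj B.obj) (hf : f.IsWeq) :
    IsIso (realize hD d (S.weqOn D).Q (isIso_weqOn_mpP hD) f) := by
  have := isIso_weqOn_mpP hD f
  have := (S.weqOn D).Q_inverts _ (weq_mpQ hD d f hf)
  rw [realize]
  infer_instance

lemma realizeClass_bijective_weqOn {N : D.FullSubcategory} (hN : S.cof N.obj)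
    (B : D.FullSubcategory) :
    Function.Bijective (realizeClass hD d (S.weqOn D).Q (isIso_weqOn_mpP hD) :
      S.HoClass N.obj B.obj → _) :=
  realizeClass_bijective hD d _ hN (fun _ _ _ hf => post_bijective_of_weq hN hf) B

lemma isCECofibrant_of_cof (d : BinaryDegree I) (hD : S.ClosedUnderMappingPath D)
    {N : D.FullSubcategory} (hN : S.cof N.obj) :
    IsCECofibrant (S.hoEquivOn D) (S.weqOn D) N :=
  fun _ _ f hf => comp_map_bijective hD d (isIso_hoEquivOn_mpP hD) hN
    (fun _ _ _ hf => post_bijective_of_hoEquivClosure d hN hf) f (post_bijective_of_weq hN hf)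

variable (hMD : M ≤ D) (hMcof : M ≤ S.cof)

lemma isStrongWeak (d : BinaryDegree I) (hD : S.ClosedUnderMappingPath D) (hMD : M ≤ D)
    (hMcof : M ≤ S.cof)
    (hM : ∀ X : Diagram C, D X → ∃ N : Diagram C, M N ∧ ∃ f : S.HoMor N X, f.IsWeq) :
    IsStrongWeak (S.hoEquivOn D) (S.weqOn D) := by
  intro A B f hf
  have key (N : D.FullSubcategory) (hN : S.cof N.obj) :
      Function.Bijective (fun g : (S.weqOn D).Q.obj N ⟶ (S.weqOn D).Q.obj A =>
        g ≫ (S.weqOn D).Q.map f) :=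
    comp_map_bijective hD d (isIso_weqOn_mpP hD) hN (fun _ _ _ hf => post_bijective_of_weq hN hf)
      f (post_bijective_of_hoEquivClosure d hN hf)
  -- Invertibility is tested on morphisms from every Z of Ho(𝓓), and each Z is isomorphic there to
  -- an object of 𝓜 through a realized weak equivalence, so the cofibrant N suffice.
  rw [isIso_iff_yoneda_map_bijective]
  intro Z
  let X := (S.weqOn D).Q.objPreimage Z
  let e : (S.weqOn D).Q.obj X ≅ Z := (S.weqOn D).Q.objObjPreimageIso Z
  obtain ⟨N, hN, g, hg⟩ := hM X.obj X.property
  let N' : D.FullSubcategory := ⟨N, hMD _ hN⟩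
  have := isIso_realize_of_isWeq hD d (A := N') (B := X) g hg
  let e' : (S.weqOn D).Q.obj N' ≅ Z :=
    asIso (realize hD d (S.weqOn D).Q (isIso_weqOn_mpP hD) (A := N') (B := X) g) ≪≫ e
  have h := key N' (hMcof _ hN)
  constructor
  · intro x y hxy
    rw [← cancel_epi e'.hom]
    apply h.1
    simpa using congrArg (fun k => e'.hom ≫ k) hxy
  · intro y
    obtain ⟨x, hx⟩ := h.2 (e'.hom ≫ y)
    exact ⟨e'.inv ≫ x, by simpa using congrArg (fun k => e'.inv ≫ k) hx⟩

/-- The realization of f already exists in 𝓓[𝓗⁻¹], since p lies in 𝓗; in Ho(𝓓) it becomes invertible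
because q is a weak equivalence. -/
lemma isLeftModel (d : BinaryDegree I) (hD : S.ClosedUnderMappingPath D)
    (h : IsStrongWeak (S.hoEquivOn D) (S.weqOn D)) {N X : D.FullSubcategory}
    (f : S.HoMor N.obj X.obj) (hf : f.IsWeq) : IsLeftModel h N X := by
  refine ⟨realize hD d _ (isIso_hoEquivOn_mpP hD) f, ?_⟩
  have hfac {A B : D.FullSubcategory} (g : A ⟶ B) :
      (Localization.Construction.lift (S.weqOn D).Q h).map ((S.hoEquivOn D).Q.map g) =
        (S.weqOn D).Q.map g :=
    (Functor.congr_hom (Localization.Construction.fac (S.weqOn D).Q h) g).trans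
      ((Category.id_comp _).trans (Category.comp_id _))
  have h₁ := isIso_hoEquivOn_mpP hD f
  have h₂ := (S.weqOn D).Q_inverts _ (weq_mpQ hD d f hf)
  rw [← hfac] at h₂
  rw [realize, Functor.map_comp]
  exact IsIso.comp_isIso' inferInstance h₂

/-- The functor from the category of homotopy classes of ho-morphisms to `Ho(D)`. -/
noncomputable def inducedFunctor : (piH d hMcof).InducedFunctor hMD where
  map {A B} x := realizeClass hD d (S.weqOn D).Q (isIso_weqOn_mpP hD)
    (A := (ObjectProperty.ιOfLE hMD).obj A) (B := (ObjectProperty.ιOfLE hMD).obj B) x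
  map_id A := realizeClass_id hD d (S.weqOn D).Q (isIso_weqOn_mpP hD)
    (A := (ObjectProperty.ιOfLE hMD).obj A)
  map_comp {A B E} x y := realizeClass_comp hD d (S.weqOn D).Q (isIso_weqOn_mpP hD)
    (A := (ObjectProperty.ιOfLE hMD).obj A) (B := (ObjectProperty.ιOfLE hMD).obj B)
    (E := (ObjectProperty.ιOfLE hMD).obj E) (hMcof _ A.property) x y
  map_toClass {A B} f X p q h := by
    have h₁ := realizeClass_pre hD d (S.weqOn D).Q (isIso_weqOn_mpP hD)
      (B := (ObjectProperty.ιOfLE hMD).obj A) (E := (ObjectProperty.ιOfLE hMD).obj B) f.toClass p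
    have h₂ := realizeClass_ofHom hD d (S.weqOn D).Q (isIso_weqOn_mpP hD) q
    exact h₁.symm.trans ((congrArg _ h).trans h₂)

lemma isEquivalence_inducedFunctor
    (hM : ∀ X : Diagram C, D X → ∃ N : Diagram C, M N ∧ ∃ f : S.HoMor N X, f.IsWeq) :
    (inducedFunctor hD d hMD hMcof).toFunctor.IsEquivalence where
  faithful := ⟨fun {A B} _ _ h => (realizeClass_bijective_weqOn hD d
    (N := (ObjectProperty.ιOfLE hMD).obj A) (hMcof _ (ObjectProperty.FullSubcategory.property A))
    ((ObjectProperty.ιOfLE hMD).obj B)).1 h⟩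
  full := ⟨fun {A B} y => (realizeClass_bijective_weqOn hD d
    (N := (ObjectProperty.ιOfLE hMD).obj A) (hMcof _ (ObjectProperty.FullSubcategory.property A))
    ((ObjectProperty.ιOfLE hMD).obj B)).2 y⟩
  essSurj := ⟨fun Z => by
    let X := (S.weqOn D).Q.objPreimage Z
    let e : (S.weqOn D).Q.obj X ≅ Z := (S.weqOn D).Q.objObjPreimageIso Z
    obtain ⟨N, hN, g, hg⟩ := hM X.obj X.property
    let N' : D.FullSubcategory := ⟨N, hMD _ hN⟩
    have := isIso_realize_of_isWeq hD d (A := N') (B := X) g hg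
    let e' : (S.weqOn D).Q.obj N' ≅ Z :=
      asIso (realize hD d (S.weqOn D).Q (isIso_weqOn_mpP hD) (A := N') (B := X) g) ≪≫ e
    exact ⟨(⟨N, hN⟩ : M.FullSubcategory), ⟨e'⟩⟩⟩

end Main

end PDiagram

end HoDiagrams

theorem mainTheorem6 {I : Type w} [SmallCategory I] [FinCategory I]
    (_deg : HoDiagrams.BinaryDegree I)
    (C : I ⥤ Cat.{v, u}) [∀ i, HasFiniteProducts (C.obj i)] (S : HoDiagrams.PDiagram C)
    (D M : ObjectProperty (HoDiagrams.Diagram C))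
    (hD : ∀ A B : HoDiagrams.Diagram C, D A → D B → ∀ f : S.HoMor A B,
      D.isoClosure (HoDiagrams.PDiagram.mappingPath f))
    (hMD : M ≤ D) (hMcof : M ≤ S.cof)
    (hM : ∀ X : HoDiagrams.Diagram C, D X →
      ∃ N : HoDiagrams.Diagram C, M N ∧ ∃ f : S.HoMor N X, f.IsWeq) :
    HoDiagrams.IsLeftCartanEilenberg (S.hoEquivOn D) (S.weqOn D) ∧
    HoDiagrams.IsSubcategoryOfCofibrantModels (S.hoEquivOn D) (S.weqOn D) (M.inverseImage D.ι) ∧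
    ∃ (T : S.PiH M) (Φ : T.InducedFunctor hMD), Φ.toFunctor.IsEquivalence := by
  have h := HoDiagrams.PDiagram.isStrongWeak _deg hD hMD hMcof hM
  have hmodel (X : D.FullSubcategory) :
      ∃ N : D.FullSubcategory, M N.obj ∧ HoDiagrams.IsLeftModel h N X := by
    obtain ⟨N, hN, f, hf⟩ := hM X.obj X.property
    exact ⟨⟨N, hMD _ hN⟩, hN, HoDiagrams.PDiagram.isLeftModel _deg hD h f hf⟩
  have hcof (N : D.FullSubcategory) (hN : M N.obj) :
      HoDiagrams.IsCECofibrant (S.hoEquivOn D) (S.weqOn D) N :=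
    HoDiagrams.PDiagram.isCECofibrant_of_cof _deg hD (hMcof _ hN)
  refine ⟨⟨h, fun X => ?_⟩, ⟨h, hcof, hmodel⟩, HoDiagrams.PDiagram.piH _deg hMcof,
    HoDiagrams.PDiagram.inducedFunctor hD _deg hMD hMcof,
    HoDiagrams.PDiagram.isEquivalence_inducedFunctor hD _deg hMD hMcof hM⟩
  obtain ⟨N, hN, hNX⟩ := hmodel X
  exact ⟨N, hcof N hN, hNX⟩
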